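/- Let $\mathcal Y$ be a finite set of $k\ge 2$ classes, let $m,n\ge 1$, $d=m+n$, and let the coordinates of $x\in\mathbb R^d$ be partitioned into sub-inputs $x^l\in\mathbb R^m$ and $x^r\in\mathbb R^n$. Let $f^l:\mathbb R^m\to\mathcal Y$ and $f^r:\mathbb R^n\to\mathcal Y$ be arbitrary deterministic or random (measurable) classifiers and let $c_A\in\mathcal Y$ be a class (in particular, the one predicted by dual randomized smoothing, DRS). Let $\Phi$ be the standard Gaussian distribution function. The Gaussian radii with noise $\mathcal N(0,\sigma^2 I)$ of randomized smoothing (RS) and of DRS are $$R'(p_A,p_B)=\tfrac{\sigma}{2}\big(\Phi^{-1}(p_A)-\Phi^{-1}(p_B)\big),$$ $$R=\tfrac{\sigma}{\sqrt2}\Big(\Phi^{-1}(p_A^l)+\Phi^{-1}(p_A^r)-2\Phi^{-1}(\tilde p/2)\Big),\qquad \tilde p=\tfrac{p_A^l+p_A^r+p_B^l+p_B^r}{2}.$$ For a probability density $q$ and a number $p$, the certified radius $r_{\rm RS}(x;q,p)\in[0,\infty]$ of RS is the supremum of all $r\ge 0$ such that, for every (deterministic or random) classifier $h$ with $\mathbb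 P_{\varepsilon\sim q}(h(x+\varepsilon)=c_A)\ge p$ and every $\|\delta\|_2\le r$, the class $c_A$ is the unique maximizer of $c\mapsto\mathbb P_{\varepsilon\sim q}(h(x+\delta+\varepsilon)=c)$ (and $0$ if there is no such $r$). Put $\Psi(r;q)=\int_{\|z\|_2<r}q(z)\,dz$ and $\Psi^{-1}(s;q)=\inf\{r\ge0:\Psi(r;q)\ge s\}\in[0,\infty]$, with $\inf\emptyset=\infty$, and $$B(q^l,q^r)=\frac{5}{\sqrt{2m}}\Psi^{-1}\!\Big(\frac{\max_c\mathbb P_{\varepsilon^l\sim q^l}(f^l(x^l+\varepsilon^l)=c)}{1-5\cdot10^{-7}};q^l\Big)+\frac{5}{\sqrt{2n}}\Psi^{-1}\!\Big(\frac{\max_c\mathbb P_{\varepsilon^r\sim q^r}(f^r(x^r+\varepsilon^r)=c)}{1-5\cdot10^{-7}};q^r\Big).$$ Then: 1. Let $\sigma>0$ and $p^l,p^r\in(0,1)$. With $p_A^l=p^l$, $p_A^r=p^r$, $p_B^l=1-p^l$, $p_B^r=1-p^r$, $$R=\tfrac1{\sqrt2}\big(R'_{x^l}+R'_{x^r}\big),\qquad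 R'_{x^l}=R'(p^l,1-p^l),\quad R'_{x^r}=R'(p^r,1-p^r),$$ and, for the Gaussian densities, $r_{\rm RS}(x^l;\mathcal N(0,\sigma^2I_m),p^l)=\max(R'_{x^l},0)$ and $r_{\rm RS}(x^r;\mathcal N(0,\sigma^2I_n),p^r)=\max(R'_{x^r},0)$. 2. If moreover $q^l,q^r$ are the densities of $\mathcal N(0,\sigma^2I_m)$, $\mathcal N(0,\sigma^2I_n)$ and $p^l\le\mathbb P(f^l(x^l+\varepsilon^l)=c_A)$, $p^r\le\mathbb P(f^r(x^r+\varepsilon^r)=c_A)$, then the radius $R$ of part 1 satisfies $R<B(q^l,q^r)$. 3. The bound holds for arbitrary continuous origin-symmetric noise: if $q^l,q^r$ are probability densities with $q(z)=q(-z)$, and $p^l,p^r<1$ satisfy $p^l\le\mathbb P_{\varepsilon^l\sim q^l}(f^l(x^l+\varepsilon^l)=c_A)$ and $p^r\le\mathbb P_{\varepsilon^r\sim q^r}(f^r(x^r+\varepsilon^r)=c_A)$, then the DRS radius $\tfrac1{\sqrt2}\big(r_{\rm RS}(x^l;q^l,p^l)+r_{\rm RS}(x^r;q^r,p^r)\big)$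 is strictly smaller than $B(q^l,q^r)$. 4. If $C\in[0,\infty]$ bounds both values of $\Psi^{-1}$ in $B(q^l,q^r)$, then $B(q^l,q^r)\le\frac{5C}{\sqrt2}\big(\frac1{\sqrt m}+\frac1{\sqrt n}\big)$; and the constants satisfy $\frac5{\sqrt d}<\frac5{\sqrt{2m}}+\frac5{\sqrt{2n}}$, where $5/\sqrt d$ is the multiplier in the corresponding upper bound for RS in dimension $d$. -/

import Mathlib

open MeasureTheory ProbabilityTheory
open scoped ENNReal NNReal

noncomputable section

/-! Randomized smoothing (RS) and dual randomized smoothing (DRS). A deterministic or random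
classifier on `ℝ^d` with finite label set `Y` is a Markov kernel from `ℝ^d` to `Y`. -/

/-- `q` is the density of a continuous, origin-symmetric probability distribution on `ℝ^d`. -/
structure IsSymmetricDensity {d : ℕ} (q : EuclideanSpace ℝ (Fin d) → ℝ) : Prop where
  measurable : Measurable q
  nonneg : ∀ z, 0 ≤ q z
  mass_one : ∫⁻ z, ENNReal.ofReal (q z) = 1
  symm : ∀ z, q (-z) = q z

/-- The distribution on `ℝ^d` with density `q`. -/
def noise {d : ℕ} (q : EuclideanSpace ℝ (Fin d) → ℝ) : Measure (EuclideanSpace ℝ (Fin d)) :=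
  volume.withDensity fun z => ENNReal.ofReal (q z)

/-- The density of `N(0, σ² I)` on `ℝ^d`. -/
def gaussianDensity (σ : ℝ) (d : ℕ) (z : EuclideanSpace ℝ (Fin d)) : ℝ :=
  (Real.sqrt (2 * Real.pi * σ ^ 2))⁻¹ ^ d * Real.exp (-‖z‖ ^ 2 / (2 * σ ^ 2))

/-- The smoothed probability `P_{ε ∼ q}(f(x + ε) = c)` of a (random) classifier `f`. -/
def classProb {d : ℕ} {Y : Type*} [MeasurableSpace Y]
    (q : EuclideanSpace ℝ (Fin d) → ℝ) (f : Kernel (EuclideanSpace ℝ (Fin d)) Y)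
    (x : EuclideanSpace ℝ (Fin d)) (c : Y) : ℝ :=
  ∫ z, (f (x + z)).real {c} ∂(noise q)

/-- The mass `Ψ(r; q)` of `q` inside the open Euclidean ball of radius `r` about the origin. -/
def ballMass {d : ℕ} (q : EuclideanSpace ℝ (Fin d) → ℝ) (r : ℝ) : ℝ :=
  ∫ z in Metric.ball (0 : EuclideanSpace ℝ (Fin d)) r, q z

/-- `Ψ⁻¹(s; q)`: the least radius of a ball of mass at least `s`; it is `∞` if there is none. -/
def ballMassInv {d : ℕ} (q : EuclideanSpace ℝ (Fin d) → ℝ) (s : ℝ) : ℝ≥0∞ :=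
  ⨅ (r : ℝ≥0) (_ : s ≤ ballMass q r), (r : ℝ≥0∞)

/-- The inverse `Φ⁻¹` of the standard Gaussian cumulative distribution function on `(0, 1)`. -/
def gaussianCdfInv (p : ℝ) : ℝ :=
  sInf {t : ℝ | p ≤ (gaussianReal 0 1).real (Set.Iic t)}

/-- The Gaussian RS radius `R'`. -/
def rsRadius (σ pA pB : ℝ) : ℝ :=
  1 / 2 * σ * (gaussianCdfInv pA - gaussianCdfInv pB)

/-- The Gaussian DRS radius `R`. -/
def drsRadius (σ pAl pAr pBl pBr : ℝ) : ℝ :=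
  σ / Real.sqrt 2 * (gaussianCdfInv pAl + gaussianCdfInv pAr
    - 2 * gaussianCdfInv ((pAl + pAr + pBl + pBr) / 2 / 2))

/-- RS with noise `q` certifies the radius `r` for the class `c` at `x` from the lower bound `p`
on the smoothed probability of `c`: for every base classifier that obeys this bound, `c` is the
unique most probable class of the smoothed classifier at all points within distance `r` of `x`. -/
def RSCertifies {d : ℕ} {Y : Type*} [MeasurableSpace Y]
    (q : EuclideanSpace ℝ (Fin d) → ℝ) (x : EuclideanSpace ℝ (Fin d)) (c : Y)
    (p : ℝ) (r : ℝ≥0) : Prop :=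
  ∀ h : Kernel (EuclideanSpace ℝ (Fin d)) Y, IsMarkovKernel h → p ≤ classProb q h x c →
    ∀ δ : EuclideanSpace ℝ (Fin d), ‖δ‖ ≤ r →
      ∀ c' : Y, c' ≠ c → classProb q h (x + δ) c' < classProb q h (x + δ) c

/-- The certified radius of RS with an arbitrary noise `q`: the supremum of the radii that RS
certifies (`0` if there is none). -/
def rsCertifiedRadius {d : ℕ} {Y : Type*} [MeasurableSpace Y]
    (q : EuclideanSpace ℝ (Fin d) → ℝ) (x : EuclideanSpace ℝ (Fin d)) (c : Y)
    (p : ℝ) : ℝ≥0∞ :=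
  ⨆ (r : ℝ≥0) (_ : RSCertifies q x c p r), (r : ℝ≥0∞)

/-- The left sub-input `x^l` of `x` for a partition `e` of the coordinates. -/
def subL {m n d : ℕ} (e : Fin m ⊕ Fin n ≃ Fin d) (x : EuclideanSpace ℝ (Fin d)) :
    EuclideanSpace ℝ (Fin m) :=
  WithLp.toLp 2 fun i => x (e (Sum.inl i))

/-- The right sub-input `x^r` of `x` for a partition `e` of the coordinates. -/
def subR {m n d : ℕ} (e : Fin m ⊕ Fin n ≃ Fin d) (x : EuclideanSpace ℝ (Fin d)) :
    EuclideanSpace ℝ (Fin n) :=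
  WithLp.toLp 2 fun i => x (e (Sum.inr i))

/-- `Ψ⁻¹(max_c P_{ε ∼ q}(f(x + ε) = c) / (1 - 5 * 10⁻⁷); q)`. -/
def psiTerm {d : ℕ} {Y : Type*} [MeasurableSpace Y]
    (q : EuclideanSpace ℝ (Fin d) → ℝ) (f : Kernel (EuclideanSpace ℝ (Fin d)) Y)
    (x : EuclideanSpace ℝ (Fin d)) : ℝ≥0∞ :=
  ballMassInv q ((⨆ c : Y, classProb q f x c) / (1 - 5 * ((10 : ℝ) ^ 7)⁻¹))

end

/-! An upper bound on the certified radius only needs one bad base classifier, and a halfspace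
suffices. Suppose a unit vector `u` and a threshold `s ≥ 0` satisfy `P(⟨u, z⟩ ≤ s) ≥ p`. The
classifier answering `c` on `x + {⟨u, z⟩ ≤ s}` obeys the bound `p`, but moving the input by `r • u`
with `r > s` lowers the threshold below zero, where symmetry of the noise leaves `c` at most mass
1/2. Hence the radius is at most `r`.

A good direction is found by averaging (`exists_unit_cap_le`). Put `η = 5·10⁻⁷` and `a² = 24.9/d`.
In a direction drawn from a standard Gaussian, a point `z` with `‖z‖ < ρ` has component above `a *
ρ` with probability at most `η`. By Fubini some `u` satisfies `P(⟨u, z⟩ > a * ρ) ≤ η Ψ(ρ) + (1 -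
Ψ(ρ))/2`, so the opposite halfspace has mass at least `(1 - η) Ψ(ρ)`. Thus `Ψ(ρ) ≥ p/(1 - η)` bounds
the radius by a number just above `a * ρ`, and `√24.9 < 5` leaves room for strict inequality
(`rsCertifiedRadius_lt`).

The numerical core is the cone estimate `stdGaussian_cone_le_of_sq`: split the Gaussian vector into
its axial and orthogonal parts, apply a one-dimensional tail bound to the former, and integrate over
the latter.

In the Gaussian case the Neyman–Pearson lemma shows that halfspaces are the worst classifiers, so
the certified radius is exactly the positive part of `R'`. The DRS statements then follow by adding
the two sub-input bounds. -/

/-! ### Noise measures and the isotropic Gaussian density. -/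

theorem IsSymmetricDensity.isProbabilityMeasure {d : ℕ} {q : EuclideanSpace ℝ (Fin d) → ℝ}
    (hq : IsSymmetricDensity q) : IsProbabilityMeasure (noise q) := by
  constructor
  rw [noise, withDensity_apply _ MeasurableSet.univ, Measure.restrict_univ, hq.mass_one]

theorem integral_noise {d : ℕ} {q : EuclideanSpace ℝ (Fin d) → ℝ} (hq : Measurable q)
    (h0 : ∀ z, 0 ≤ q z) {G : Type*} [NormedAddCommGroup G] [NormedSpace ℝ G]
    (g : EuclideanSpace ℝ (Fin d) → G) :
    ∫ z, g z ∂(noise q) = ∫ z, q z • g z := by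
  rw [noise, integral_withDensity_eq_integral_toReal_smul (by fun_prop)
    (Filter.Eventually.of_forall fun z => ENNReal.ofReal_lt_top)]
  simp [ENNReal.toReal_ofReal (h0 _)]

theorem measurable_gaussianDensity (σ : ℝ) (d : ℕ) : Measurable (gaussianDensity σ d) := by
  unfold gaussianDensity
  fun_prop

theorem gaussianDensity_nonneg (σ : ℝ) (d : ℕ) (z : EuclideanSpace ℝ (Fin d)) :
    0 ≤ gaussianDensity σ d z := by
  unfold gaussianDensity
  positivity

/-- The case `c = 0` normalizes the density; general `c` is the Laplace transform of `‖z‖²` needed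
for the cone estimate. -/
theorem integral_exp_neg_mul_sq_norm_gaussianDensity {σ : ℝ} (hσ : 0 < σ) (d : ℕ) {c : ℝ}
    (hc : 0 ≤ c) :
    ∫ z, gaussianDensity σ d z * Real.exp (-c * ‖z‖ ^ 2 / (2 * σ ^ 2))
      = (Real.sqrt (1 + c))⁻¹ ^ d := by
  have hb : 0 < (1 + c) / (2 * σ ^ 2) := by positivity
  have h := GaussianFourier.integral_rexp_neg_mul_sq_norm
    (V := EuclideanSpace ℝ (Fin d)) hb
  have h2 : ∀ z : EuclideanSpace ℝ (Fin d),
      gaussianDensity σ d z * Real.exp (-c * ‖z‖ ^ 2 / (2 * σ ^ 2))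
      = (Real.sqrt (2 * Real.pi * σ ^ 2))⁻¹ ^ d *
        Real.exp (-((1 + c) / (2 * σ ^ 2)) * ‖z‖ ^ 2) := by
    intro z
    rw [gaussianDensity, mul_assoc, ← Real.exp_add]
    congr 2
    field_simp
    ring
  simp_rw [h2]
  rw [integral_const_mul, h, finrank_euclideanSpace_fin, Real.rpow_div_two_eq_sqrt _ (by positivity),
    Real.rpow_natCast, ← mul_pow]
  congr 1
  rw [← Real.sqrt_inv, ← Real.sqrt_mul (by positivity), ← Real.sqrt_inv]
  congr 1
  field_simp

theorem isSymmetricDensity_gaussianDensity {σ : ℝ} (hσ : 0 < σ) (d : ℕ) :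
    IsSymmetricDensity (gaussianDensity σ d) where
  measurable := measurable_gaussianDensity σ d
  nonneg := gaussianDensity_nonneg σ d
  symm z := by simp [gaussianDensity]
  mass_one := by
    have h : ∫ z, gaussianDensity σ d z = 1 := by
      simpa using integral_exp_neg_mul_sq_norm_gaussianDensity hσ d le_rfl
    -- The integral of a non-integrable function is 0 by convention, so the value 1 already forces
    -- integrability.
    have hi : Integrable (gaussianDensity σ d) := by
      by_contra hn
      rw [integral_undef hn] at h
      simp at h
    rw [← ofReal_integral_eq_lintegral_ofReal hi
      (Filter.Eventually.of_forall (gaussianDensity_nonneg σ d)), h, ENNReal.ofReal_one]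

theorem charFun_noise_gaussianDensity {σ : ℝ} (hσ : 0 < σ) (d : ℕ)
    (t : EuclideanSpace ℝ (Fin d)) :
    charFun (noise (gaussianDensity σ d)) t = Complex.exp (-(σ ^ 2 * ‖t‖ ^ 2 / 2 : ℝ)) := by
  have hb : 0 < ((1 / (2 * σ ^ 2) : ℝ) : ℂ).re := by
    rw [Complex.ofReal_re]; positivity
  have h := GaussianFourier.integral_cexp_neg_mul_sq_norm_add hb Complex.I t
  have h0 := GaussianFourier.integral_cexp_neg_mul_sq_norm (V := EuclideanSpace ℝ (Fin d)) hb
  rw [← h0] at h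
  rw [charFun_apply, integral_noise (measurable_gaussianDensity σ d) (gaussianDensity_nonneg σ d)]
  have e1 : ∀ z : EuclideanSpace ℝ (Fin d),
      gaussianDensity σ d z • Complex.exp (inner ℝ z t * Complex.I)
      = ((Real.sqrt (2 * Real.pi * σ ^ 2))⁻¹ ^ d : ℝ) *
        Complex.exp (-((1 / (2 * σ ^ 2) : ℝ) : ℂ) * ‖z‖ ^ 2 + Complex.I * inner ℝ t z) := by
    intro z
    rw [gaussianDensity, Complex.real_smul, Complex.ofReal_mul, mul_assoc, Complex.ofReal_exp,
      ← Complex.exp_add, real_inner_comm]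
    congr 2
    push_cast
    ring
  have e2 : ∫ z, ((gaussianDensity σ d z : ℝ) : ℂ) = 1 := by
    rw [integral_complex_ofReal]
    have : ∫ z, gaussianDensity σ d z = 1 := by
      simpa using integral_exp_neg_mul_sq_norm_gaussianDensity hσ d le_rfl
    rw [this, Complex.ofReal_one]
  have e3 : ∀ z : EuclideanSpace ℝ (Fin d), ((gaussianDensity σ d z : ℝ) : ℂ)
      = ((Real.sqrt (2 * Real.pi * σ ^ 2))⁻¹ ^ d : ℝ) *
        Complex.exp (-((1 / (2 * σ ^ 2) : ℝ) : ℂ) * ‖z‖ ^ 2) := by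
    intro z
    rw [gaussianDensity, Complex.ofReal_mul, Complex.ofReal_exp]
    congr 2
    push_cast
    ring
  simp_rw [e3] at e2
  rw [integral_const_mul] at e2
  simp_rw [e1]
  rw [integral_const_mul, h, ← mul_assoc, e2, one_mul]
  congr 1
  have : (σ : ℂ) ≠ 0 := by exact_mod_cast hσ.ne'
  push_cast
  rw [Complex.I_sq]
  field_simp
  ring

theorem noise_gaussianDensity_one (d : ℕ) :
    noise (gaussianDensity 1 d) = stdGaussian (EuclideanSpace ℝ (Fin d)) := by
  have := (isSymmetricDensity_gaussianDensity one_pos d).isProbabilityMeasure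
  refine Measure.ext_of_charFun ?_
  ext t
  rw [charFun_noise_gaussianDensity one_pos, charFun_stdGaussian]
  push_cast
  congr 1
  ring

/-- Evaluating the characteristic function along the line `t • u` gives that of the one-dimensional
marginal. -/
theorem map_inner_noise_gaussianDensity {σ : ℝ} (hσ : 0 < σ) {d : ℕ}
    (u : EuclideanSpace ℝ (Fin d)) :
    (noise (gaussianDensity σ d)).map (fun z => inner ℝ u z)
      = gaussianReal 0 (.mk ((σ * ‖u‖) ^ 2) (sq_nonneg _)) := by
  have := (isSymmetricDensity_gaussianDensity hσ d).isProbabilityMeasure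
  have : IsProbabilityMeasure ((noise (gaussianDensity σ d)).map (fun z => inner ℝ u z)) :=
    Measure.isProbabilityMeasure_map (by fun_prop)
  refine Measure.ext_of_charFun ?_
  ext t
  rw [charFun_apply_real, integral_map (by fun_prop) (by fun_prop), charFun_gaussianReal]
  have h := charFun_noise_gaussianDensity hσ d (t • u)
  rw [charFun_apply] at h
  simp_rw [inner_smul_right, real_inner_comm u] at h
  push_cast at h ⊢
  rw [h]
  congr 1
  rw [norm_smul]
  push_cast
  have : ((‖t‖ : ℝ) : ℂ) ^ 2 = (t : ℂ) ^ 2 := by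
    norm_cast; simp
  rw [mul_pow, this]
  ring

/-! ### The Gaussian distribution function, its inverse, and the Gaussian radii. -/

/-- The standard Gaussian distribution function `Φ`. -/
noncomputable def gaussianCdf (t : ℝ) : ℝ := (gaussianReal 0 1).real (Set.Iic t)

theorem strictMono_gaussianCdf : StrictMono gaussianCdf := by
  intro a b hab
  have h1 : Set.Iic b = Set.Iic a ∪ Set.Ioc a b := (Set.Iic_union_Ioc_eq_Iic hab.le).symm
  have h2 : gaussianCdf b = gaussianCdf a + (gaussianReal 0 1).real (Set.Ioc a b) := by
    rw [gaussianCdf, h1, measureReal_union (Set.Iic_disjoint_Ioc le_rfl) measurableSet_Ioc,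
      gaussianCdf]
  have h3 : 0 < (gaussianReal 0 1).real (Set.Ioc a b) := by
    refine ENNReal.toReal_pos (fun h => ?_) (measure_ne_top _ _)
    have := gaussianReal_absolutelyContinuous' 0 one_ne_zero h
    rw [Real.volume_Ioc, ENNReal.ofReal_eq_zero] at this
    linarith
  linarith

theorem continuous_gaussianCdf : Continuous gaussianCdf := by
  have hi := integrable_gaussianPDFReal 0 1
  have h : ∀ t, gaussianCdf t
      = gaussianCdf 0 + ∫ x in (0 : ℝ)..t, gaussianPDFReal 0 1 x := by
    intro t
    have h0 : ∀ s, gaussianCdf s = ∫ x in Set.Iic s, gaussianPDFReal 0 1 x := by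
      intro s
      rw [gaussianCdf, measureReal_def, gaussianReal_apply_eq_integral 0 one_ne_zero,
        ENNReal.toReal_ofReal]
      exact setIntegral_nonneg measurableSet_Iic fun x _ => gaussianPDFReal_nonneg 0 1 x
    rw [h0, h0, ← intervalIntegral.integral_Iic_sub_Iic hi.integrableOn hi.integrableOn]
    ring
  rw [show gaussianCdf = fun t => gaussianCdf 0 + ∫ x in (0 : ℝ)..t, gaussianPDFReal 0 1 x from
    funext h]
  exact continuous_const.add (intervalIntegral.continuous_primitive
    (fun a b => hi.intervalIntegrable) 0)

theorem gaussianCdf_neg (t : ℝ) : gaussianCdf (-t) = 1 - gaussianCdf t := by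
  have := nullSingletonClass_gaussianReal (μ := 0) (v := 1) one_ne_zero
  have h : gaussianCdf (-t) = (gaussianReal 0 1).real (Set.Ici t) := by
    have h1 : (gaussianReal 0 1).map (fun x => -x) = gaussianReal 0 1 := by
      rw [gaussianReal_map_neg, neg_zero]
    rw [gaussianCdf, ← h1, map_measureReal_apply measurable_neg measurableSet_Iic, h1]
    congr 1
    ext x
    simp
  rw [h, gaussianCdf, ← Set.compl_Iio, measureReal_compl measurableSet_Iio, probReal_univ,
    measureReal_congr Iio_ae_eq_Iic]

theorem gaussianCdf_zero : gaussianCdf 0 = 1 / 2 := by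
  have := gaussianCdf_neg 0
  rw [neg_zero] at this
  linarith

theorem exists_gaussianCdf_eq {p : ℝ} (h0 : 0 < p) (h1 : p < 1) : ∃ t, gaussianCdf t = p := by
  have hb := tendsto_cdf_atBot (gaussianReal 0 1)
  have ht := tendsto_cdf_atTop (gaussianReal 0 1)
  have he : ∀ t, cdf (gaussianReal 0 1) t = gaussianCdf t := fun t => cdf_eq_real _ t
  obtain ⟨a, ha⟩ := (hb.eventually (gt_mem_nhds h0)).exists
  obtain ⟨b, hb⟩ := (ht.eventually (lt_mem_nhds h1)).exists
  rw [he] at ha hb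
  exact mem_range_of_exists_le_of_exists_ge continuous_gaussianCdf ⟨a, ha.le⟩ ⟨b, hb.le⟩

theorem gaussianCdfInv_gaussianCdf (t : ℝ) : gaussianCdfInv (gaussianCdf t) = t := by
  have : {s : ℝ | gaussianCdf t ≤ (gaussianReal 0 1).real (Set.Iic s)} = Set.Ici t := by
    ext s
    exact strictMono_gaussianCdf.le_iff_le
  rw [gaussianCdfInv, this, csInf_Ici]

theorem gaussianCdf_gaussianCdfInv {p : ℝ} (h0 : 0 < p) (h1 : p < 1) :
    gaussianCdf (gaussianCdfInv p) = p := by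
  obtain ⟨t, rfl⟩ := exists_gaussianCdf_eq h0 h1
  rw [gaussianCdfInv_gaussianCdf]

theorem gaussianCdfInv_one_sub {p : ℝ} (h0 : 0 < p) (h1 : p < 1) :
    gaussianCdfInv (1 - p) = -gaussianCdfInv p := by
  obtain ⟨t, rfl⟩ := exists_gaussianCdf_eq h0 h1
  rw [← gaussianCdf_neg, gaussianCdfInv_gaussianCdf, gaussianCdfInv_gaussianCdf]

theorem gaussianCdfInv_half : gaussianCdfInv (1 / 2) = 0 := by
  rw [← gaussianCdf_zero, gaussianCdfInv_gaussianCdf]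

theorem rsRadius_one_sub (σ : ℝ) {p : ℝ} (h0 : 0 < p) (h1 : p < 1) :
    rsRadius σ p (1 - p) = σ * gaussianCdfInv p := by
  rw [rsRadius, gaussianCdfInv_one_sub h0 h1]
  ring

/-- With complementary runner-up probabilities `p̃/2 = 1/2`, so the correction term `Φ⁻¹(1/2)`
vanishes. -/
theorem drsRadius_one_sub (σ : ℝ) {pl pr : ℝ} (hl0 : 0 < pl) (hl1 : pl < 1) (hr0 : 0 < pr)
    (hr1 : pr < 1) :
    drsRadius σ pl pr (1 - pl) (1 - pr)
      = 1 / Real.sqrt 2 * (rsRadius σ pl (1 - pl) + rsRadius σ pr (1 - pr)) := by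
  rw [rsRadius_one_sub σ hl0 hl1, rsRadius_one_sub σ hr0 hr1, drsRadius,
    show (pl + pr + (1 - pl) + (1 - pr)) / 2 / 2 = 1 / 2 by ring, gaussianCdfInv_half]
  ring

theorem noise_gaussianDensity_halfspace {σ : ℝ} (hσ : 0 < σ) {d : ℕ}
    {u : EuclideanSpace ℝ (Fin d)} (hu : u ≠ 0) (s : ℝ) :
    (noise (gaussianDensity σ d)).real {z | inner ℝ u z ≤ s} = gaussianCdf (s / (σ * ‖u‖)) := by
  have hc : 0 < σ * ‖u‖ := mul_pos hσ (norm_pos_iff.2 hu)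
  have h1 := map_inner_noise_gaussianDensity hσ u
  have h2 := gaussianReal_map_const_mul (μ := 0) (v := 1) (σ * ‖u‖)
  rw [mul_zero, mul_one, ← h1] at h2
  have h3 : {z | inner ℝ u z ≤ s} = (fun z => inner ℝ u z) ⁻¹' Set.Iic s := rfl
  rw [h3, ← map_measureReal_apply (by fun_prop) measurableSet_Iic, ← h2,
    map_measureReal_apply (by fun_prop) measurableSet_Iic, gaussianCdf]
  congr 1
  ext x
  simp only [Set.mem_preimage, Set.mem_Iic]
  rw [le_div_iff₀ hc, mul_comm]

/-! ### Smoothed classifiers, halfspace counterexamples and Neyman–Pearson. -/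

section Classifiers

variable {d : ℕ} {Y : Type*} [MeasurableSpace Y]

theorem measurable_kernel_real [MeasurableSingletonClass Y]
    (h : Kernel (EuclideanSpace ℝ (Fin d)) Y)
    (x : EuclideanSpace ℝ (Fin d)) (c : Y) : Measurable fun z => (h (x + z)).real {c} :=
  ((h.measurable_coe (measurableSet_singleton c)).comp (measurable_const_add x)).ennreal_toReal

theorem integrable_kernel_real [MeasurableSingletonClass Y]
    (μ : Measure (EuclideanSpace ℝ (Fin d))) [IsFiniteMeasure μ]
    (h : Kernel (EuclideanSpace ℝ (Fin d)) Y) [IsMarkovKernel h]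
    (x : EuclideanSpace ℝ (Fin d)) (c : Y) : Integrable (fun z => (h (x + z)).real {c}) μ := by
  refine Integrable.of_bound (measurable_kernel_real h x c).aestronglyMeasurable 1
    (Filter.Eventually.of_forall fun z => ?_)
  rw [Real.norm_of_nonneg measureReal_nonneg]
  exact measureReal_le_one

theorem classProb_add_le_one [MeasurableSingletonClass Y] {q : EuclideanSpace ℝ (Fin d) → ℝ}
    (hq : IsSymmetricDensity q)
    (h : Kernel (EuclideanSpace ℝ (Fin d)) Y) [IsMarkovKernel h] (x : EuclideanSpace ℝ (Fin d))
    {c c' : Y} (hc : c' ≠ c) : classProb q h x c' + classProb q h x c ≤ 1 := by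
  have := hq.isProbabilityMeasure
  rw [classProb, classProb, ← integral_add (integrable_kernel_real _ h x c')
    (integrable_kernel_real _ h x c)]
  have h1 : ∫ _, (1 : ℝ) ∂(noise q) = 1 := by simp
  rw [← h1]
  refine integral_mono ((integrable_kernel_real _ h x c').add
    (integrable_kernel_real _ h x c)) (integrable_const 1) fun z => ?_
  have hd : Disjoint ({c'} : Set Y) {c} := by simpa using hc
  simp only
  rw [← measureReal_union hd (measurableSet_singleton c)]
  exact measureReal_le_one

theorem sum_classProb [Fintype Y] [MeasurableSingletonClass Y]
    {q : EuclideanSpace ℝ (Fin d) → ℝ} (hq : IsSymmetricDensity q)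
    (h : Kernel (EuclideanSpace ℝ (Fin d)) Y) [IsMarkovKernel h] (x : EuclideanSpace ℝ (Fin d)) :
    ∑ c, classProb q h x c = 1 := by
  have := hq.isProbabilityMeasure
  simp only [classProb]
  rw [← integral_finsetSum _ fun c _ => integrable_kernel_real _ h x c]
  have : ∀ z, ∑ c, (h (x + z)).real {c} = 1 := by
    intro z
    rw [sum_measureReal_singleton]
    simp
  simp [this]

open Classical in
/-- The classifier that answers `c` on `S` and `c'` elsewhere. -/
noncomputable def indicatorClassifier {S : Set (EuclideanSpace ℝ (Fin d))} (hS : MeasurableSet S)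
    (c c' : Y) : Kernel (EuclideanSpace ℝ (Fin d)) Y :=
  Kernel.deterministic (fun y => if y ∈ S then c else c')
    (Measurable.ite hS measurable_const measurable_const)

instance {S : Set (EuclideanSpace ℝ (Fin d))} (hS : MeasurableSet S) (c c' : Y) :
    IsMarkovKernel (indicatorClassifier hS c c') := by
  unfold indicatorClassifier
  infer_instance

theorem classProb_indicatorClassifier [MeasurableSingletonClass Y]
    (q : EuclideanSpace ℝ (Fin d) → ℝ)
    {S : Set (EuclideanSpace ℝ (Fin d))} (hS : MeasurableSet S) {c c' : Y} (hc : c' ≠ c)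
    (x : EuclideanSpace ℝ (Fin d)) :
    classProb q (indicatorClassifier hS c c') x c = (noise q).real {z | x + z ∈ S} := by
  have hm : MeasurableSet {z | x + z ∈ S} := measurable_const_add x hS
  rw [classProb, ← integral_indicator_one hm]
  congr 1
  ext z
  rw [indicatorClassifier, Kernel.deterministic_apply, measureReal_def,
    Measure.dirac_apply' _ (measurableSet_singleton c)]
  by_cases hz : x + z ∈ S <;> simp [hz, hc]

theorem classProb_indicatorClassifier_compl [MeasurableSingletonClass Y]
    (q : EuclideanSpace ℝ (Fin d) → ℝ)
    {S : Set (EuclideanSpace ℝ (Fin d))} (hS : MeasurableSet S) {c c' : Y} (hc : c' ≠ c)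
    (x : EuclideanSpace ℝ (Fin d)) :
    classProb q (indicatorClassifier hS c c') x c' = (noise q).real {z | x + z ∈ S}ᶜ := by
  have hm : MeasurableSet {z | x + z ∈ S}ᶜ := (measurable_const_add x hS).compl
  rw [classProb, ← integral_indicator_one hm]
  congr 1
  ext z
  rw [indicatorClassifier, Kernel.deterministic_apply, measureReal_def,
    Measure.dirac_apply' _ (measurableSet_singleton c')]
  by_cases hz : x + z ∈ S <;> simp [hz, hc.symm]

/-- The two-valued halfspace classifier is the counterexample: after the shift `c` has probability
at most 1/2 and the only other answer `c'` has the rest, so `c` is not the unique maximizer. -/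
theorem not_rsCertifies_of_halfspace [Nontrivial Y] [MeasurableSingletonClass Y]
    {q : EuclideanSpace ℝ (Fin d) → ℝ}
    (hq : IsSymmetricDensity q) (x u δ : EuclideanSpace ℝ (Fin d)) (c : Y) {p s : ℝ} {r : ℝ≥0}
    (hp : p ≤ (noise q).real {z | inner ℝ u z ≤ s}) (hδ : ‖δ‖ ≤ r)
    (hs : (noise q).real {z | inner ℝ u z ≤ s - inner ℝ u δ} ≤ 1 / 2) :
    ¬ RSCertifies q x c p r := by
  intro h
  have := hq.isProbabilityMeasure
  obtain ⟨c', hc⟩ := exists_ne c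
  have hS : MeasurableSet {y | inner ℝ u (y - x) ≤ s} :=
    measurableSet_le (by fun_prop) measurable_const
  have h1 : ∀ δ, {z | x + δ + z ∈ {y | inner ℝ u (y - x) ≤ s}}
      = {z | inner ℝ u z ≤ s - inner ℝ u δ} := by
    intro δ
    ext z
    simp only [Set.mem_ofPred_eq]
    rw [show x + δ + z - x = z + δ by abel, inner_add_right, le_sub_iff_add_le]
  have h0 := h1 0
  rw [add_zero, inner_zero_right, sub_zero] at h0
  have h2 := h (indicatorClassifier hS c c') inferInstance
    (by rw [classProb_indicatorClassifier q hS hc, h0]; exact hp) δ hδ c' hc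
  rw [classProb_indicatorClassifier q hS hc, classProb_indicatorClassifier_compl q hS hc, h1,
    probReal_compl_eq_one_sub (measurableSet_le (by fun_prop) measurable_const)] at h2
  linarith

/-- Certifying a radius certifies all smaller ones, so one failure bounds the supremum. -/
theorem rsCertifiedRadius_le {q : EuclideanSpace ℝ (Fin d) → ℝ} {x : EuclideanSpace ℝ (Fin d)}
    {c : Y} {p : ℝ} {r : ℝ≥0} (h : ¬ RSCertifies q x c p r) : rsCertifiedRadius q x c p ≤ r := by
  refine iSup₂_le fun r' hr' => ?_
  by_contra hlt
  rw [not_le, ENNReal.coe_lt_coe] at hlt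
  exact h fun k hk hp δ hδ => hr' k hk hp δ (hδ.trans (NNReal.coe_le_coe.2 hlt.le))

theorem gaussianDensity_sub {σ : ℝ} (hσ : 0 < σ) (w δ : EuclideanSpace ℝ (Fin d)) :
    gaussianDensity σ d (w - δ) = gaussianDensity σ d w *
      Real.exp ((2 * inner ℝ δ w - ‖δ‖ ^ 2) / (2 * σ ^ 2)) := by
  simp only [gaussianDensity]
  rw [mul_assoc _ (Real.exp _) (Real.exp _), ← Real.exp_add, @norm_sub_sq ℝ, real_inner_comm]
  congr 2
  simp only [RCLike.re_to_real]
  field_simp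
  ring

theorem integrable_density {q : EuclideanSpace ℝ (Fin d) → ℝ} (hq : IsSymmetricDensity q) :
    Integrable q := by
  refine ⟨hq.measurable.aestronglyMeasurable, ?_⟩
  rw [hasFiniteIntegral_iff_ofReal (Filter.Eventually.of_forall hq.nonneg), hq.mass_one]
  exact ENNReal.one_lt_top

theorem noise_real_eq {q : EuclideanSpace ℝ (Fin d) → ℝ} (hq : IsSymmetricDensity q)
    {S : Set (EuclideanSpace ℝ (Fin d))} (hS : MeasurableSet S) :
    (noise q).real S = ∫ z, q z * S.indicator 1 z := by
  rw [← integral_indicator_one hS, integral_noise hq.measurable hq.nonneg]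
  rfl

/-- The likelihood ratio of the shifted to the unshifted noise increases with `⟨δ, w⟩`, so among
classifiers with at least the mass of `H` before the shift, `H` loses the most. `K` is the ratio on
the boundary of `H`. -/
theorem neyman_pearson_gaussian [MeasurableSingletonClass Y] {σ : ℝ} (hσ : 0 < σ)
    (h : Kernel (EuclideanSpace ℝ (Fin d)) Y) [IsMarkovKernel h]
    (x δ : EuclideanSpace ℝ (Fin d)) (c : Y) (τ : ℝ)
    (hp : (noise (gaussianDensity σ d)).real {z | inner ℝ δ z ≤ τ}
      ≤ classProb (gaussianDensity σ d) h x c) :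
    (noise (gaussianDensity σ d)).real {z | inner ℝ δ z ≤ τ - ‖δ‖ ^ 2}
      ≤ classProb (gaussianDensity σ d) h (x + δ) c := by
  have hq := isSymmetricDensity_gaussianDensity hσ d
  have hqi := integrable_density hq
  set q := gaussianDensity σ d with hqdef
  set H : Set (EuclideanSpace ℝ (Fin d)) := {z | inner ℝ δ z ≤ τ} with hH
  have hHm : MeasurableSet H := measurableSet_le (by fun_prop) measurable_const
  have hHm' : MeasurableSet {z | inner ℝ δ z ≤ τ - ‖δ‖ ^ 2} :=
    measurableSet_le (by fun_prop) measurable_const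
  set G : EuclideanSpace ℝ (Fin d) → ℝ := fun w => (h (x + w)).real {c} with hG
  have hG0 : ∀ w, 0 ≤ G w := fun w => measureReal_nonneg
  have hG1 : ∀ w, G w ≤ 1 := fun w => measureReal_le_one
  have hGm : Measurable G := measurable_kernel_real h x c
  set K := Real.exp ((2 * τ - ‖δ‖ ^ 2) / (2 * σ ^ 2)) with hK
  have e1 : classProb q h x c = ∫ w, q w * G w := by
    rw [classProb, integral_noise hq.measurable hq.nonneg]; rfl
  have e2 : classProb q h (x + δ) c = ∫ w, q (w - δ) * G w := by
    rw [classProb, integral_noise hq.measurable hq.nonneg, ← integral_sub_right_eq_self _ δ]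
    simp [hG, smul_eq_mul, add_assoc]
  have e3 : (noise q).real {z | inner ℝ δ z ≤ τ - ‖δ‖ ^ 2}
      = ∫ w, q (w - δ) * H.indicator 1 w := by
    rw [noise_real_eq hq hHm', ← integral_sub_right_eq_self _ δ]
    congr 1
    ext w
    congr 1
    simp only [Set.indicator_apply, Set.mem_ofPred_eq, hH, inner_sub_right,
      real_inner_self_eq_norm_sq, sub_le_sub_iff_right, Pi.one_apply]
  have hqi' : Integrable fun w => q (w - δ) := hqi.comp_sub_right δ
  have hIm : Measurable (H.indicator (1 : EuclideanSpace ℝ (Fin d) → ℝ)) :=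
    measurable_one.indicator hHm
  have hIb : ∀ w, ‖H.indicator (1 : EuclideanSpace ℝ (Fin d) → ℝ) w‖ ≤ 1 := by
    intro w
    by_cases hw : w ∈ H <;> simp [hw]
  have hGb : ∀ w, ‖G w‖ ≤ 1 := fun w => by
    rw [Real.norm_of_nonneg (hG0 w)]; exact hG1 w
  have i1 := hqi.mul_bdd (c := 1) hGm.aestronglyMeasurable (Filter.Eventually.of_forall hGb)
  have i2 := hqi'.mul_bdd (c := 1) hGm.aestronglyMeasurable (Filter.Eventually.of_forall hGb)
  have i3 := hqi.mul_bdd (c := 1) hIm.aestronglyMeasurable (Filter.Eventually.of_forall hIb)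
  have i4 := hqi'.mul_bdd (c := 1) hIm.aestronglyMeasurable (Filter.Eventually.of_forall hIb)
  -- Integrated form of `(q(w - δ) - K q(w)) (1_H - G) ≤ 0`: the first factor is nonpositive on `H`
  -- and nonnegative off it, the second has the opposite signs.
  have key : ∫ w, (q (w - δ) * H.indicator 1 w + K * (q w * G w))
      ≤ ∫ w, (q (w - δ) * G w + K * (q w * H.indicator 1 w)) := by
    refine integral_mono (i4.add (i1.const_mul K)) (i2.add (i3.const_mul K)) fun w => ?_
    simp only
    rw [hqdef, gaussianDensity_sub hσ, ← hqdef]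
    have hqw := hq.nonneg w
    by_cases hw : w ∈ H
    · have : Real.exp ((2 * inner ℝ δ w - ‖δ‖ ^ 2) / (2 * σ ^ 2)) ≤ K := by
        rw [hK]
        have : inner ℝ δ w ≤ τ := hw
        gcongr
      simp only [hw, Set.indicator_of_mem, Pi.one_apply]
      nlinarith [mul_nonneg hqw (mul_nonneg (sub_nonneg.2 this) (sub_nonneg.2 (hG1 w)))]
    · have : K ≤ Real.exp ((2 * inner ℝ δ w - ‖δ‖ ^ 2) / (2 * σ ^ 2)) := by
        rw [hK]
        have : τ ≤ inner ℝ δ w := (not_le.1 hw).le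
        gcongr
      simp only [hw, Set.indicator_of_notMem, not_false_eq_true]
      nlinarith [mul_nonneg hqw (mul_nonneg (sub_nonneg.2 this) (hG0 w))]
  rw [integral_add i4 (i1.const_mul K), integral_add i2 (i3.const_mul K), integral_const_mul,
    integral_const_mul, ← e1, ← e2, ← e3, ← noise_real_eq hq hHm] at key
  have hKpos : 0 < K := Real.exp_pos _
  nlinarith

theorem exists_norm_eq_one (hd : 0 < d) : ∃ u : EuclideanSpace ℝ (Fin d), ‖u‖ = 1 :=
  ⟨EuclideanSpace.single ⟨0, hd⟩ 1, by simp⟩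

theorem rsCertifiedRadius_gaussianDensity [Nontrivial Y] [MeasurableSingletonClass Y] {σ : ℝ}
    (hσ : 0 < σ) (hd : 0 < d) (x : EuclideanSpace ℝ (Fin d)) (c : Y) {p : ℝ} (h0 : 0 < p)
    (h1 : p < 1) :
    rsCertifiedRadius (gaussianDensity σ d) x c p = ENNReal.ofReal (rsRadius σ p (1 - p)) := by
  have hq := isSymmetricDensity_gaussianDensity hσ d
  have hp := gaussianCdf_gaussianCdfInv h0 h1
  rw [rsRadius_one_sub σ h0 h1]
  set t := gaussianCdfInv p
  apply le_antisymm
  · obtain ⟨u, hu⟩ := exists_norm_eq_one hd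
    have hu0 : u ≠ 0 := norm_ne_zero_iff.1 (by rw [hu]; exact one_ne_zero)
    refine rsCertifiedRadius_le (r := (σ * t).toNNReal) ?_
    -- The halfspace at `σ * t` has mass exactly `p`. If `t < 0` the truncated shift is zero and the
    -- threshold is already negative.
    refine not_rsCertifies_of_halfspace hq x u (((σ * t).toNNReal : ℝ) • u) c (s := σ * t) ?_ ?_ ?_
    · rw [noise_gaussianDensity_halfspace hσ hu0, hu, mul_one, mul_div_cancel_left₀ _ hσ.ne', hp]
    · rw [norm_smul, hu, mul_one, Real.norm_of_nonneg (NNReal.coe_nonneg _)]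
    · rw [noise_gaussianDensity_halfspace hσ hu0, ← gaussianCdf_zero, inner_smul_right,
        real_inner_self_eq_norm_sq, hu, one_pow, mul_one, mul_one]
      refine strictMono_gaussianCdf.monotone (div_nonpos_of_nonpos_of_nonneg ?_ hσ.le)
      rw [Real.coe_toNNReal']
      linarith [le_max_left (σ * t) 0]
  · refine ENNReal.le_of_forall_nnreal_lt fun r hr => ?_
    have hr' : (r : ℝ) < σ * t := by
      rwa [ENNReal.ofReal, ENNReal.coe_lt_coe, Real.lt_toNNReal_iff_coe_lt] at hr
    refine le_iSup₂ (f := fun (r : ℝ≥0) (_ : RSCertifies (gaussianDensity σ d) x c p r) =>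
      (r : ℝ≥0∞)) r ?_
    intro h hh hph δ hδ c' hc
    have hadd := classProb_add_le_one hq h (x + δ) hc
    suffices 1 / 2 < classProb (gaussianDensity σ d) h (x + δ) c by linarith
    -- For `δ = 0` there is no halfspace direction; a nonnegative `r` below `σ * t` still forces `t
    -- > 0`, hence `p > 1/2`.
    by_cases hδ0 : δ = 0
    · have ht : 0 < t := by
        have : 0 < σ * t := lt_of_le_of_lt r.coe_nonneg hr'
        exact pos_of_mul_pos_right this hσ.le
      have := strictMono_gaussianCdf ht
      rw [gaussianCdf_zero, hp] at this
      rw [hδ0, add_zero]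
      linarith
    · have hn : 0 < ‖δ‖ := norm_pos_iff.2 hδ0
      have h2 := neyman_pearson_gaussian hσ h x δ c (t * (σ * ‖δ‖)) (by
        rw [noise_gaussianDensity_halfspace hσ hδ0, mul_div_cancel_right₀ _ (by positivity), hp]
        exact hph)
      rw [noise_gaussianDensity_halfspace hσ hδ0] at h2
      refine lt_of_lt_of_le ?_ h2
      rw [← gaussianCdf_zero]
      refine strictMono_gaussianCdf (div_pos ?_ (by positivity))
      nlinarith

end Classifiers

/-! ### One-dimensional Gaussian tail bounds. -/

/-- On `(y, ∞)` one has `1 ≤ x / y`, and `x * exp (-x² / 2)` has an explicit primitive. -/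
theorem gaussianReal_Ioi_le_mills {y : ℝ} (hy : 0 < y) :
    (gaussianReal 0 1).real (Set.Ioi y)
      ≤ (y * Real.sqrt (2 * Real.pi))⁻¹ * Real.exp (-y ^ 2 / 2) := by
  have hd : ∀ x ∈ Set.Ici y, HasDerivAt (fun x : ℝ => -Real.exp (-x ^ 2 / 2))
      (x * Real.exp (-x ^ 2 / 2)) x := by
    intro x _
    have h1 : HasDerivAt (fun x : ℝ => -x ^ 2 / 2) (-x) x := by
      have := ((hasDerivAt_pow 2 x).neg).div_const 2
      convert! this using 1
      simp
      ring
    convert! h1.exp.neg using 1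
    ring
  have hn : ∀ x ∈ Set.Ioi y, 0 ≤ x * Real.exp (-x ^ 2 / 2) := fun x hx =>
    mul_nonneg (hy.le.trans (le_of_lt hx)) (Real.exp_pos _).le
  have ht : Filter.Tendsto (fun x : ℝ => -Real.exp (-x ^ 2 / 2)) Filter.atTop (nhds 0) := by
    rw [← neg_zero]
    refine (Real.tendsto_exp_atBot.comp ?_).neg
    have := (Filter.tendsto_pow_atTop (α := ℝ) two_ne_zero).atTop_div_const two_pos
    have h2 := Filter.tendsto_neg_atTop_atBot.comp this
    refine h2.congr fun x => ?_
    simp only [Function.comp]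
    ring
  have hI := integral_Ioi_of_hasDerivAt_of_nonneg' hd hn ht
  have hint := integrableOn_Ioi_deriv_of_nonneg' hd hn ht
  rw [measureReal_def, gaussianReal_apply_eq_integral 0 one_ne_zero, ENNReal.toReal_ofReal
    (setIntegral_nonneg measurableSet_Ioi fun x _ => gaussianPDFReal_nonneg 0 1 x)]
  have hle : ∫ x in Set.Ioi y, gaussianPDFReal 0 1 x
      ≤ ∫ x in Set.Ioi y, (y * Real.sqrt (2 * Real.pi))⁻¹ * (x * Real.exp (-x ^ 2 / 2)) := by
    refine setIntegral_mono_on (integrable_gaussianPDFReal 0 1).integrableOn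
      (hint.const_mul _) measurableSet_Ioi fun x hx => ?_
    have hx' : y < x := hx
    rw [gaussianPDFReal_def]
    simp only [NNReal.coe_one, mul_one, sub_zero]
    rw [mul_inv, mul_assoc, mul_comm y⁻¹, mul_assoc]
    refine mul_le_mul_of_nonneg_left ?_ (by positivity)
    rw [mul_comm x, mul_assoc]
    refine le_mul_of_one_le_right (Real.exp_pos _).le ?_
    rw [← div_eq_mul_inv, one_le_div hy]
    exact hx'.le
  rw [integral_const_mul, hI] at hle
  simpa using hle

theorem gaussianReal_Ioi_le_exp {y : ℝ} (hy : 0 ≤ y) :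
    (gaussianReal 0 1).real (Set.Ioi y) ≤ Real.exp (-y ^ 2 / 2) := by
  have h := measure_ge_le_exp_mul_mgf (μ := gaussianReal 0 1) (X := id) y hy
    (integrable_exp_mul_gaussianReal y)
  rw [mgf_id_gaussianReal, ← Real.exp_add] at h
  have hsub : Set.Ioi y ⊆ {x : ℝ | y ≤ id x} := fun x hx => le_of_lt (Set.mem_Ioi.1 hx)
  refine (measureReal_mono hsub).trans (h.trans (le_of_eq ?_))
  congr 1
  simp
  ring

/-- A bound valid for all `y ≥ 0`, built from exponentials in `y²` so that it integrates in closed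
form. The Chernoff factor 1 is too weak for the target `5·10⁻⁷`; from `y = 3.64` on, Mills' factor
is at most 0.11. Below that, `y² ≤ 53/4`, and the second exponential dominates the Chernoff bound.
-/
theorem gaussianReal_Ioi_le {y : ℝ} (hy : 0 ≤ y) :
    (gaussianReal 0 1).real (Set.Ioi y) ≤ 11 / 100 * Real.exp (-(1 * y ^ 2) / 2)
      + Real.exp (3 / 4 * (53 / 8)) * Real.exp (-(7 / 4 * y ^ 2) / 2) := by
  rcases le_or_gt (91 / 25) y with h | h
  · have hpi : (5 / 2 : ℝ) ≤ Real.sqrt (2 * Real.pi) := by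
      apply Real.le_sqrt_of_sq_le
      linarith [Real.pi_gt_d2]
    have h1 : (y * Real.sqrt (2 * Real.pi))⁻¹ ≤ 11 / 100 := by
      apply inv_le_of_inv_le₀ (by norm_num)
      nlinarith
    refine (gaussianReal_Ioi_le_mills (by linarith)).trans ?_
    rw [one_mul]
    have := mul_le_mul_of_nonneg_right h1 (Real.exp_pos (-y ^ 2 / 2)).le
    have h2 : 0 < Real.exp (3 / 4 * (53 / 8)) * Real.exp (-(7 / 4 * y ^ 2) / 2) := by positivity
    linarith
  · refine (gaussianReal_Ioi_le_exp hy).trans ?_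
    have h2 : 0 < Real.exp (-(1 * y ^ 2) / 2) := Real.exp_pos _
    have h3 : Real.exp (-y ^ 2 / 2)
        ≤ Real.exp (3 / 4 * (53 / 8)) * Real.exp (-(7 / 4 * y ^ 2) / 2) := by
      rw [← Real.exp_add]
      apply Real.exp_le_exp.2
      nlinarith
    linarith

/-! ### The Gaussian measure of a circular cone. -/

section Sphere

variable {d : ℕ}

/-- The component along `e` may be replaced by an independent standard normal: by Pythagoras the
characteristic functions of the two parts multiply to that of the whole. -/
theorem stdGaussian_eq_map_prod {e : EuclideanSpace ℝ (Fin d)} (he : ‖e‖ = 1) :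
    ((gaussianReal 0 1).prod (stdGaussian (EuclideanSpace ℝ (Fin d)))).map
      (fun p => p.1 • e + (p.2 - inner ℝ e p.2 • e))
      = stdGaussian (EuclideanSpace ℝ (Fin d)) := by
  have hm : Measurable fun p : ℝ × EuclideanSpace ℝ (Fin d) =>
      p.1 • e + (p.2 - inner ℝ e p.2 • e) := by fun_prop
  have := Measure.isProbabilityMeasure_map (μ := (gaussianReal 0 1).prod
    (stdGaussian (EuclideanSpace ℝ (Fin d)))) hm.aemeasurable
  refine Measure.ext_of_charFun ?_
  ext t
  rw [charFun_apply, integral_map hm.aemeasurable (by fun_prop)]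
  have h1 : ∀ p : ℝ × EuclideanSpace ℝ (Fin d),
      Complex.exp (inner ℝ (p.1 • e + (p.2 - inner ℝ e p.2 • e)) t * Complex.I)
      = Complex.exp (inner ℝ e t * p.1 * Complex.I) *
        Complex.exp (inner ℝ p.2 (t - (inner ℝ e t : ℝ) • e) * Complex.I) := by
    intro p
    rw [← Complex.exp_add, inner_add_left, inner_sub_left, inner_smul_left, inner_smul_left,
      inner_sub_right, inner_smul_right, real_inner_comm p.2 e]
    congr 1
    simp
    ring
  simp_rw [h1]
  rw [integral_prod_mul (μ := gaussianReal 0 1) (ν := stdGaussian (EuclideanSpace ℝ (Fin d)))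
    (fun x : ℝ => Complex.exp (inner ℝ e t * x * Complex.I))
    (fun s => Complex.exp (inner ℝ s (t - (inner ℝ e t : ℝ) • e) * Complex.I)),
    ← charFun_apply_real, ← charFun_apply, charFun_gaussianReal, charFun_stdGaussian,
    charFun_stdGaussian, ← Complex.exp_add]
  congr 1
  have h2 : ‖t - (inner ℝ e t : ℝ) • e‖ ^ 2 = ‖t‖ ^ 2 - (inner ℝ e t) ^ 2 := by
    rw [@norm_sub_sq ℝ, inner_smul_right, norm_smul, he, real_inner_comm]
    simp
    ring
  have h3 : ((‖t - (inner ℝ e t : ℝ) • e‖ : ℝ) : ℂ) ^ 2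
      = (‖t‖ : ℂ) ^ 2 - ((inner ℝ e t : ℝ) : ℂ) ^ 2 := by exact_mod_cast h2
  rw [h3]
  simp
  ring

theorem norm_sq_smul_add {e : EuclideanSpace ℝ (Fin d)} (he : ‖e‖ = 1) (a : ℝ)
    (s : EuclideanSpace ℝ (Fin d)) :
    ‖a • e + (s - inner ℝ e s • e)‖ ^ 2 = a ^ 2 + ‖s - inner ℝ e s • e‖ ^ 2 := by
  rw [@norm_add_sq ℝ, norm_smul, he, inner_smul_left, inner_sub_right, inner_smul_right,
    real_inner_self_eq_norm_sq, he]
  simp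

theorem inner_smul_add {e : EuclideanSpace ℝ (Fin d)} (he : ‖e‖ = 1) (a : ℝ)
    (s : EuclideanSpace ℝ (Fin d)) :
    inner ℝ e (a • e + (s - inner ℝ e s • e)) = a := by
  rw [inner_add_right, inner_sub_right, inner_smul_right, inner_smul_right,
    real_inner_self_eq_norm_sq, he]
  ring

theorem integral_exp_neg_mul_sq_gaussianReal {c : ℝ} (hc : 0 ≤ c) :
    ∫ x, Real.exp (-(c * x ^ 2) / 2) ∂(gaussianReal 0 1) = (Real.sqrt (1 + c))⁻¹ := by
  rw [integral_gaussianReal_eq_integral_smul one_ne_zero]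
  have h : ∀ x : ℝ, gaussianPDFReal 0 1 x • Real.exp (-(c * x ^ 2) / 2)
      = (Real.sqrt (2 * Real.pi))⁻¹ * Real.exp (-((1 + c) / 2) * x ^ 2) := by
    intro x
    rw [gaussianPDFReal_def]
    simp only [NNReal.coe_one, mul_one, sub_zero, smul_eq_mul]
    rw [mul_assoc, ← Real.exp_add]
    congr 2
    ring
  simp_rw [h]
  rw [integral_const_mul, integral_gaussian, ← Real.sqrt_inv, ← Real.sqrt_mul (by positivity),
    ← Real.sqrt_inv]
  congr 1
  field_simp

theorem integral_exp_neg_mul_norm_sq_stdGaussian {c : ℝ} (hc : 0 ≤ c) :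
    ∫ z, Real.exp (-(c * ‖z‖ ^ 2) / 2) ∂(stdGaussian (EuclideanSpace ℝ (Fin d)))
      = (Real.sqrt (1 + c))⁻¹ ^ d := by
  rw [← noise_gaussianDensity_one, integral_noise (measurable_gaussianDensity 1 d)
    (gaussianDensity_nonneg 1 d), ← integral_exp_neg_mul_sq_norm_gaussianDensity one_pos d hc]
  congr 1
  ext z
  simp

/-- Dividing the full `d`-dimensional integral by its axial factor leaves the exponent `d - 1`,
without parametrizing the hyperplane orthogonal to `e`. -/
theorem integral_exp_neg_mul_norm_sq_orthogonal (hd : 0 < d) {e : EuclideanSpace ℝ (Fin d)}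
    (he : ‖e‖ = 1) {c : ℝ} (hc : 0 ≤ c) :
    ∫ s, Real.exp (-(c * ‖s - inner ℝ e s • e‖ ^ 2) / 2)
      ∂(stdGaussian (EuclideanSpace ℝ (Fin d))) = (Real.sqrt (1 + c))⁻¹ ^ (d - 1) := by
  have h := integral_exp_neg_mul_norm_sq_stdGaussian (d := d) hc
  rw [← stdGaussian_eq_map_prod he, integral_map (Measurable.aemeasurable (by fun_prop))
    (by fun_prop)] at h
  simp_rw [norm_sq_smul_add he] at h
  have h1 : ∀ p : ℝ × EuclideanSpace ℝ (Fin d),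
      Real.exp (-(c * (p.1 ^ 2 + ‖p.2 - inner ℝ e p.2 • e‖ ^ 2)) / 2)
      = Real.exp (-(c * p.1 ^ 2) / 2) *
        Real.exp (-(c * ‖p.2 - inner ℝ e p.2 • e‖ ^ 2) / 2) := by
    intro p
    rw [← Real.exp_add]
    congr 1
    ring
  simp_rw [h1] at h
  rw [integral_prod_mul (μ := gaussianReal 0 1) (ν := stdGaussian (EuclideanSpace ℝ (Fin d)))
    (fun x : ℝ => Real.exp (-(c * x ^ 2) / 2))
    (fun s => Real.exp (-(c * ‖s - inner ℝ e s • e‖ ^ 2) / 2)),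
    integral_exp_neg_mul_sq_gaussianReal hc] at h
  obtain ⟨k, rfl⟩ : ∃ k, d = k + 1 := ⟨d - 1, by omega⟩
  rw [pow_succ', mul_right_inj' (by positivity)] at h
  rw [h, Nat.add_sub_cancel]

theorem stdGaussian_cone_le (hd : 0 < d) {e : EuclideanSpace ℝ (Fin d)} (he : ‖e‖ = 1) {a : ℝ}
    (ha0 : 0 ≤ a) (ha1 : a < 1) :
    stdGaussian (EuclideanSpace ℝ (Fin d)) {g | a * ‖g‖ < inner ℝ e g}
      ≤ ENNReal.ofReal (11 / 100 * (Real.sqrt (1 + a ^ 2 / (1 - a ^ 2)))⁻¹ ^ (d - 1)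
        + Real.exp (3 / 4 * (53 / 8)) *
          (Real.sqrt (1 + 7 / 4 * (a ^ 2 / (1 - a ^ 2))))⁻¹ ^ (d - 1)) := by
  have ha2 : 0 < 1 - a ^ 2 := by nlinarith
  set b := a ^ 2 / (1 - a ^ 2) with hb
  have hb0 : 0 ≤ b := by positivity
  have hm : Measurable fun p : ℝ × EuclideanSpace ℝ (Fin d) =>
      p.1 • e + (p.2 - inner ℝ e p.2 • e) := by fun_prop
  have hS : MeasurableSet {g : EuclideanSpace ℝ (Fin d) | a * ‖g‖ < inner ℝ e g} :=
    measurableSet_lt (by fun_prop) (by fun_prop)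
  rw [← stdGaussian_eq_map_prod he, Measure.map_apply hm hS,
    Measure.prod_apply_symm (hm hS)]
  have hi : ∀ c : ℝ, 0 ≤ c → Integrable (fun s : EuclideanSpace ℝ (Fin d) =>
      Real.exp (-(c * ‖s - inner ℝ e s • e‖ ^ 2) / 2))
      (stdGaussian (EuclideanSpace ℝ (Fin d))) := by
    intro c hc
    refine Integrable.of_bound (by fun_prop) 1 (Filter.Eventually.of_forall fun s => ?_)
    rw [Real.norm_of_nonneg (Real.exp_pos _).le, Real.exp_le_one_iff]
    have : 0 ≤ c * ‖s - inner ℝ e s • e‖ ^ 2 := by positivity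
    linarith
  have hi2 : Integrable (fun s : EuclideanSpace ℝ (Fin d) =>
      11 / 100 * Real.exp (-(b * ‖s - inner ℝ e s • e‖ ^ 2) / 2) + Real.exp (3 / 4 * (53 / 8)) *
        Real.exp (-(7 / 4 * b * ‖s - inner ℝ e s • e‖ ^ 2) / 2))
      (stdGaussian (EuclideanSpace ℝ (Fin d))) :=
    ((hi _ hb0).const_mul _).add ((hi _ (by positivity)).const_mul _)
  rw [← integral_exp_neg_mul_norm_sq_orthogonal hd he hb0,
    ← integral_exp_neg_mul_norm_sq_orthogonal hd he (c := 7 / 4 * b) (by positivity),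
    ← integral_const_mul, ← integral_const_mul, ← integral_add ((hi _ hb0).const_mul _)
      ((hi _ (by positivity)).const_mul _),
    ofReal_integral_eq_lintegral_ofReal hi2 (Filter.Eventually.of_forall fun s => by
        simp only [Pi.zero_apply]; positivity)]
  refine lintegral_mono fun s => ?_
  set N := ‖s - inner ℝ e s • e‖ with hN
  have hsub : (fun x : ℝ => (x, s)) ⁻¹' ((fun p : ℝ × EuclideanSpace ℝ (Fin d) =>
      p.1 • e + (p.2 - inner ℝ e p.2 • e)) ⁻¹' {g | a * ‖g‖ < inner ℝ e g})
      ⊆ Set.Ioi (Real.sqrt b * N) := by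
    intro x hx
    simp only [Set.mem_preimage, Set.mem_ofPred_eq, inner_smul_add he] at hx
    have h1 := norm_sq_smul_add he x s
    set M := ‖x • e + (s - inner ℝ e s • e)‖
    have hM : 0 ≤ a * M := mul_nonneg ha0 (norm_nonneg _)
    -- With `M² = x² + N²` this rearranges to `x² > b * N²`, so the slice of the cone is contained
    -- in a half-line.
    have h2 : (a * M) ^ 2 < x ^ 2 := by nlinarith
    rw [mul_pow, h1] at h2
    refine lt_of_pow_lt_pow_left₀ 2 (hM.trans hx.le) ?_
    rw [mul_pow, Real.sq_sqrt hb0, hb, div_mul_eq_mul_div, div_lt_iff₀ ha2]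
    rw [← hN] at h2
    linarith
  refine (measure_mono hsub).trans ?_
  rw [← ofReal_measureReal]
  refine ENNReal.ofReal_le_ofReal ?_
  have h := gaussianReal_Ioi_le (y := Real.sqrt b * N) (by positivity)
  rw [mul_pow, Real.sq_sqrt hb0] at h
  simpa only [one_mul, mul_assoc] using h

theorem inv_sqrt_pow_le {n : ℕ} {x y : ℝ} (hx : 0 ≤ x) (hy : y ≤ n / 2 * (2 * x / (x + 2))) :
    (Real.sqrt (1 + x))⁻¹ ^ n ≤ Real.exp (-y) := by
  have h1 := Real.le_log_one_add_of_nonneg hx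
  have h2 : Real.sqrt (1 + x) = Real.exp (Real.log (1 + x) / 2) := by
    rw [← Real.log_sqrt (by linarith), Real.exp_log (by positivity)]
  rw [h2, ← Real.exp_neg, ← Real.exp_nat_mul]
  apply Real.exp_le_exp.2
  have : (n : ℝ) / 2 * (2 * x / (x + 2)) ≤ n / 2 * Real.log (1 + x) := by gcongr
  linarith

/-- The two terms are at most `0.11/250000 = 4.4·10⁻⁷` and `1/18000000 < 5.6·10⁻⁸`. -/
theorem exp_tail_bound : 11 / 100 * Real.exp (-(249 / 20))
    + Real.exp (3 / 4 * (53 / 8)) * Real.exp (-(7 / 4 * (249 / 20)))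
      ≤ 5 * ((10 : ℝ) ^ 7)⁻¹ := by
  have he := Real.exp_one_gt_d9
  have h1 : (250000 : ℝ) ≤ Real.exp (249 / 20) := by
    have e1 : Real.exp (249 / 20) = Real.exp 1 ^ 12 * Real.exp (9 / 20) := by
      rw [← Real.exp_nat_mul, ← Real.exp_add]; norm_num
    have e2 : (1 : ℝ) + 9 / 20 + (9 / 20) ^ 2 / 2 ≤ Real.exp (9 / 20) :=
      Real.quadratic_le_exp_of_nonneg (by norm_num)
    rw [e1]
    calc (250000 : ℝ) ≤ (2.718 : ℝ) ^ 12 * (1 + 9 / 20 + (9 / 20) ^ 2 / 2) := by norm_num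
      _ ≤ _ := by gcongr; linarith
  have h2 : (18000000 : ℝ) ≤ Real.exp (7 / 4 * (249 / 20) - 3 / 4 * (53 / 8)) := by
    have e1 : Real.exp (7 / 4 * (249 / 20) - 3 / 4 * (53 / 8))
        = Real.exp 1 ^ 16 * Real.exp (131 / 160) := by
      rw [← Real.exp_nat_mul, ← Real.exp_add]; norm_num
    have e2 : (1 : ℝ) + 131 / 160 + (131 / 160) ^ 2 / 2 ≤ Real.exp (131 / 160) :=
      Real.quadratic_le_exp_of_nonneg (by norm_num)
    rw [e1]
    calc (18000000 : ℝ) ≤ (2.718 : ℝ) ^ 16 * (1 + 131 / 160 + (131 / 160) ^ 2 / 2) := by norm_num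
      _ ≤ _ := by gcongr; linarith
  rw [← Real.exp_add, show 3 / 4 * (53 / 8) + -(7 / 4 * (249 / 20))
    = -(7 / 4 * (249 / 20) - 3 / 4 * (53 / 8) : ℝ) by ring, Real.exp_neg, Real.exp_neg]
  have h3 := inv_anti₀ (by norm_num) h1
  have h4 := inv_anti₀ (by norm_num) h2
  norm_num at h3 h4 ⊢
  linarith

theorem stdGaussian_cone_le_of_sq (hd : 0 < d) {e : EuclideanSpace ℝ (Fin d)} (he : ‖e‖ = 1)
    {a : ℝ} (ha0 : 0 ≤ a) (ha : a ^ 2 = 249 / 10 / d) :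
    stdGaussian (EuclideanSpace ℝ (Fin d)) {g | a * ‖g‖ < inner ℝ e g}
      ≤ ENNReal.ofReal (5 * ((10 : ℝ) ^ 7)⁻¹) := by
  rcases lt_or_ge a 1 with ha1 | ha1
  · refine (stdGaussian_cone_le hd he ha0 ha1).trans (ENNReal.ofReal_le_ofReal ?_)
    refine le_trans ?_ exp_tail_bound
    have hd0 : (0 : ℝ) < d := by exact_mod_cast hd
    have ha2 : a ^ 2 < 1 := by nlinarith
    have hdT : (249 / 10 : ℝ) < d := by
      rwa [ha, div_lt_one hd0] at ha2
    have hb : a ^ 2 / (1 - a ^ 2) = 249 / 10 / (d - 249 / 10) := by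
      rw [ha]
      have : (d : ℝ) - 249 / 10 ≠ 0 := by linarith
      field_simp
    have hpos : (0 : ℝ) < d - 249 / 10 := by linarith
    rw [hb, show -(249 / 20 : ℝ) = -(1 * (249 / 20)) by ring]
    have hc : ((d - 1 : ℕ) : ℝ) = d - 1 := by
      rw [Nat.cast_sub hd, Nat.cast_one]
    have key : ∀ γ : ℝ, 0 < γ → γ ≤ 7 / 4 →
        -- Clearing denominators leaves `2 ≤ (2 - γ) * 249 / 10`; this is why the second exponential
        -- rate, 7/4, is kept below 2.
        γ * (249 / 20) ≤ ((d - 1 : ℕ) : ℝ) / 2 * (2 * (γ * (249 / 10 / (d - 249 / 10)))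
          / (γ * (249 / 10 / (d - 249 / 10)) + 2)) := by
      intro γ h0 h1
      rw [hc]
      have : ((d : ℝ) - 1) / 2 * (2 * (γ * (249 / 10 / (d - 249 / 10)))
          / (γ * (249 / 10 / (d - 249 / 10)) + 2))
          = γ * (249 / 10) * (d - 1) / (γ * (249 / 10) + 2 * (d - 249 / 10)) := by
        generalize (d : ℝ) - 249 / 10 = D at hpos ⊢
        field_simp
      rw [this, le_div_iff₀ (by positivity)]
      nlinarith [mul_nonneg h0.le (sub_nonneg.2 h1)]
    have k1 := inv_sqrt_pow_le (n := d - 1) (by positivity) (key 1 one_pos (by norm_num))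
    have k2 := inv_sqrt_pow_le (n := d - 1) (by positivity) (key (7 / 4) (by norm_num) le_rfl)
    rw [one_mul] at k1
    gcongr
  -- In low dimension `a ≥ 1`, and Cauchy–Schwarz empties the cone.
  · have : {g : EuclideanSpace ℝ (Fin d) | a * ‖g‖ < inner ℝ e g} = ∅ := by
      ext g
      simp only [Set.mem_ofPred_eq, Set.mem_empty_iff_false, iff_false, not_lt]
      have := real_inner_le_norm e g
      rw [he, one_mul] at this
      nlinarith [norm_nonneg g]
    rw [this, measure_empty]
    exact zero_le

end Sphere

/-! ### From cone estimates to the bound on the certified radius. -/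

section Radius

variable {d : ℕ}

theorem stdGaussian_cap_le (hd : 0 < d) {a ρ : ℝ} (ha0 : 0 ≤ a) (ha : a ^ 2 = 249 / 10 / d)
    (hρ : 0 ≤ ρ) {z : EuclideanSpace ℝ (Fin d)} (hz : ‖z‖ ≤ ρ) :
    stdGaussian (EuclideanSpace ℝ (Fin d)) {g | a * ρ * ‖g‖ < inner ℝ g z}
      ≤ ENNReal.ofReal (5 * ((10 : ℝ) ^ 7)⁻¹) := by
  by_cases hz0 : z = 0
  · have : {g : EuclideanSpace ℝ (Fin d) | a * ρ * ‖g‖ < inner ℝ g z} = ∅ := by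
      ext g
      simp only [Set.mem_ofPred_eq, Set.mem_empty_iff_false, iff_false, not_lt, hz0,
        inner_zero_right]
      positivity
    rw [this, measure_empty]
    exact zero_le
  · have hn : 0 < ‖z‖ := norm_pos_iff.2 hz0
    refine (measure_mono ?_).trans
      (stdGaussian_cone_le_of_sq hd (e := (‖z‖⁻¹ : ℝ) • z) (norm_smul_inv_norm (𝕜 := ℝ) hz0) ha0 ha)
    intro g hg
    simp only [Set.mem_ofPred_eq] at hg ⊢
    rw [inner_smul_left, real_inner_comm]
    simp only [conj_trivial]
    rw [inv_mul_eq_div, lt_div_iff₀ hn]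
    refine lt_of_le_of_lt ?_ hg
    nlinarith [mul_nonneg (mul_nonneg ha0 (norm_nonneg g)) (sub_nonneg.2 hz)]

theorem stdGaussian_cap_le_half {s : ℝ} (hs : 0 ≤ s) (z : EuclideanSpace ℝ (Fin d)) :
    stdGaussian (EuclideanSpace ℝ (Fin d)) {g | s * ‖g‖ < inner ℝ g z} ≤ ENNReal.ofReal (1 / 2) := by
  by_cases hz0 : z = 0
  · have : {g : EuclideanSpace ℝ (Fin d) | s * ‖g‖ < inner ℝ g z} = ∅ := by
      ext g
      simp only [Set.mem_ofPred_eq, Set.mem_empty_iff_false, iff_false, not_lt, hz0,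
        inner_zero_right]
      positivity
    rw [this, measure_empty]
    exact zero_le
  · have h := noise_gaussianDensity_halfspace one_pos hz0 0
    rw [zero_div, gaussianCdf_zero, noise_gaussianDensity_one] at h
    have hm : MeasurableSet {g : EuclideanSpace ℝ (Fin d) | inner ℝ z g ≤ 0} :=
      measurableSet_le (by fun_prop) measurable_const
    have h2 := probReal_compl_eq_one_sub (μ := stdGaussian (EuclideanSpace ℝ (Fin d))) hm
    rw [h] at h2
    have hsub : {g | s * ‖g‖ < inner ℝ g z} ⊆ {g : EuclideanSpace ℝ (Fin d) | inner ℝ z g ≤ 0}ᶜ := by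
      intro g hg
      simp only [Set.mem_compl_iff, Set.mem_ofPred_eq, not_le] at hg ⊢
      rw [real_inner_comm]
      exact lt_of_le_of_lt (by positivity) hg
    refine (measure_mono hsub).trans ?_
    rw [← ofReal_measureReal, h2]
    exact ENNReal.ofReal_le_ofReal (by norm_num)

theorem ballMass_eq {q : EuclideanSpace ℝ (Fin d) → ℝ} (hq : IsSymmetricDensity q) (r : ℝ) :
    ballMass q r = (noise q).real (Metric.ball 0 r) := by
  rw [ballMass, noise_real_eq hq measurableSet_ball, ← integral_indicator measurableSet_ball]
  congr 1
  ext z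
  by_cases hz : z ∈ Metric.ball (0 : EuclideanSpace ℝ (Fin d)) r <;> simp [hz]

theorem stdGaussian_singleton_zero (hd : 0 < d) :
    stdGaussian (EuclideanSpace ℝ (Fin d)) {0} = 0 := by
  have : Nonempty (Fin d) := ⟨⟨0, hd⟩⟩
  rw [← noise_gaussianDensity_one, noise]
  exact withDensity_absolutelyContinuous _ _ (measure_singleton 0)

/-- Average the cap mass over a Gaussian `g` and exchange the integrals: each `z` in the ball
contributes at most `5·10⁻⁷`, each other `z` at most 1/2. Some direction does no worse than the
average. -/
theorem exists_unit_cap_le (hd : 0 < d) {q : EuclideanSpace ℝ (Fin d) → ℝ}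
    (hq : IsSymmetricDensity q) {a ρ : ℝ} (ha0 : 0 ≤ a) (ha : a ^ 2 = 249 / 10 / d) (hρ : 0 ≤ ρ) :
    ∃ u : EuclideanSpace ℝ (Fin d), ‖u‖ = 1 ∧ (noise q).real {z | a * ρ < inner ℝ u z}
      ≤ 5 * ((10 : ℝ) ^ 7)⁻¹ * ballMass q ρ + 1 / 2 * (1 - ballMass q ρ) := by
  have := hq.isProbabilityMeasure
  set G := stdGaussian (EuclideanSpace ℝ (Fin d)) with hG
  have hBm : MeasurableSet (Metric.ball (0 : EuclideanSpace ℝ (Fin d)) ρ) := measurableSet_ball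
  set B := Metric.ball (0 : EuclideanSpace ℝ (Fin d)) ρ with hB
  set S : Set (EuclideanSpace ℝ (Fin d) × EuclideanSpace ℝ (Fin d)) :=
    {p | a * ρ * ‖p.1‖ < inner ℝ p.1 p.2} with hS
  have hSm : MeasurableSet S := measurableSet_lt (by fun_prop) (by fun_prop)
  have h1 : ∫⁻ g, noise q (Prod.mk g ⁻¹' S) ∂G
      ≤ ENNReal.ofReal (5 * ((10 : ℝ) ^ 7)⁻¹ * ballMass q ρ + 1 / 2 * (1 - ballMass q ρ)) := by
    rw [← Measure.prod_apply hSm, Measure.prod_apply_symm hSm]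
    have h2 : ∀ z, G ((fun g => (g, z)) ⁻¹' S)
        ≤ B.indicator (fun _ => ENNReal.ofReal (5 * ((10 : ℝ) ^ 7)⁻¹)) z
          + Bᶜ.indicator (fun _ => ENNReal.ofReal (1 / 2)) z := by
      intro z
      by_cases hz : z ∈ B
      · have : z ∉ Bᶜ := fun h => h hz
        rw [Set.indicator_of_mem hz, Set.indicator_of_notMem this, add_zero]
        exact stdGaussian_cap_le hd ha0 ha hρ (mem_ball_zero_iff.1 hz).le
      · have : z ∈ Bᶜ := hz
        rw [Set.indicator_of_notMem hz, Set.indicator_of_mem this, zero_add]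
        exact stdGaussian_cap_le_half (mul_nonneg ha0 hρ) z
    refine (lintegral_mono h2).trans ?_
    rw [lintegral_add_left (measurable_const.indicator hBm), lintegral_indicator_const hBm,
      lintegral_indicator_const hBm.compl, ballMass_eq hq, ← probReal_compl_eq_one_sub hBm,
      ENNReal.ofReal_add (by positivity) (by positivity),
      ENNReal.ofReal_mul (p := 5 * ((10 : ℝ) ^ 7)⁻¹) (by positivity),
      ENNReal.ofReal_mul (p := 1 / 2) (by positivity), ofReal_measureReal, ofReal_measureReal]
  have hmeas : Measurable fun g => noise q (Prod.mk g ⁻¹' S) := measurable_measure_prodMk_left hSm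
  -- The null set `{0}` is avoided so that `g` can be normalized.
  obtain ⟨g, hg0, hg⟩ := exists_notMem_null_le_lintegral (μ := G) hmeas.aemeasurable
    (stdGaussian_singleton_zero hd)
  have hg0' : g ≠ 0 := hg0
  have hn : 0 < ‖g‖ := norm_pos_iff.2 hg0'
  refine ⟨(‖g‖⁻¹ : ℝ) • g, norm_smul_inv_norm (𝕜 := ℝ) hg0', ?_⟩
  have hset : {z | a * ρ < inner ℝ ((‖g‖⁻¹ : ℝ) • g) z} = Prod.mk g ⁻¹' S := by
    ext z
    simp only [Set.mem_ofPred_eq, hS, Set.mem_preimage]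
    rw [inner_smul_left]
    simp only [conj_trivial]
    rw [inv_mul_eq_div, lt_div_iff₀ hn]
  rw [hset, measureReal_def]
  have hΨ1 : ballMass q ρ ≤ 1 := by rw [ballMass_eq hq]; exact measureReal_le_one
  have hΨ0 : 0 ≤ ballMass q ρ := by rw [ballMass_eq hq]; exact measureReal_nonneg
  have hΨ2 := sub_nonneg.2 hΨ1
  exact ENNReal.toReal_le_of_le_ofReal (by positivity) (hg.trans h1)

theorem noise_preimage_neg {q : EuclideanSpace ℝ (Fin d) → ℝ} (hq : IsSymmetricDensity q)
    {S : Set (EuclideanSpace ℝ (Fin d))} (hS : MeasurableSet S) :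
    (noise q).real (Neg.neg ⁻¹' S) = (noise q).real S := by
  rw [noise_real_eq hq hS, noise_real_eq hq (measurable_neg hS),
    ← integral_neg_eq_self (fun z => q z * S.indicator 1 z)]
  congr 1
  ext z
  rw [hq.symm]
  rfl

theorem noise_halfspace_le_half {q : EuclideanSpace ℝ (Fin d) → ℝ} (hq : IsSymmetricDensity q)
    (u : EuclideanSpace ℝ (Fin d)) {s : ℝ} (hs : s < 0) :
    (noise q).real {z | inner ℝ u z ≤ s} ≤ 1 / 2 := by
  have := hq.isProbabilityMeasure
  have hm : MeasurableSet {z : EuclideanSpace ℝ (Fin d) | inner ℝ u z ≤ s} :=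
    measurableSet_le (by fun_prop) measurable_const
  have h1 := noise_preimage_neg hq hm
  have hd : Disjoint (Neg.neg ⁻¹' {z : EuclideanSpace ℝ (Fin d) | inner ℝ u z ≤ s})
      {z | inner ℝ u z ≤ s} := by
    rw [Set.disjoint_left]
    intro z h2 h3
    simp only [Set.mem_preimage, Set.mem_ofPred_eq, inner_neg_right] at h2 h3
    linarith
  have h2 := measureReal_union (μ := noise q) hd hm
  have h3 : (noise q).real (Neg.neg ⁻¹' {z : EuclideanSpace ℝ (Fin d) | inner ℝ u z ≤ s} ∪
    {z | inner ℝ u z ≤ s}) ≤ 1 := measureReal_le_one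
  linarith

variable {Y : Type*} [MeasurableSpace Y]

theorem rsCertifiedRadius_le_of_halfspace [Nontrivial Y] [MeasurableSingletonClass Y]
    {q : EuclideanSpace ℝ (Fin d) → ℝ}
    (hq : IsSymmetricDensity q) (x : EuclideanSpace ℝ (Fin d)) (c : Y)
    {u : EuclideanSpace ℝ (Fin d)} (hu : ‖u‖ = 1) {p s r : ℝ} (hr : 0 ≤ r) (hsr : s < r)
    (hp : p ≤ (noise q).real {z | inner ℝ u z ≤ s}) :
    rsCertifiedRadius q x c p ≤ ENNReal.ofReal r := by
  refine rsCertifiedRadius_le (r := r.toNNReal)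
    (not_rsCertifies_of_halfspace hq x u (r • u) c hp ?_ ?_)
  · rw [norm_smul, hu, mul_one, Real.norm_of_nonneg hr, Real.coe_toNNReal r hr]
  · apply noise_halfspace_le_half hq
    rw [inner_smul_right, real_inner_self_eq_norm_sq, hu]
    linarith

theorem rsCertifiedRadius_le_of_ballMass [Nontrivial Y] [MeasurableSingletonClass Y] (hd : 0 < d)
    {q : EuclideanSpace ℝ (Fin d) → ℝ}
    (hq : IsSymmetricDensity q) (x : EuclideanSpace ℝ (Fin d)) (c : Y) {p s ρ : ℝ}
    (hp : p ≤ s * (1 - 5 * ((10 : ℝ) ^ 7)⁻¹)) (hρ : 0 < ρ) (hs : s ≤ ballMass q ρ) :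
    rsCertifiedRadius q x c p ≤ ENNReal.ofReal (4999 / 1000 / Real.sqrt d * ρ) := by
  have := hq.isProbabilityMeasure
  have hd0 : (0 : ℝ) < d := by exact_mod_cast hd
  obtain ⟨u, hu, h⟩ := exists_unit_cap_le hd hq (a := Real.sqrt (249 / 10) / Real.sqrt d)
    (by positivity) (by rw [div_pow, Real.sq_sqrt (by norm_num), Real.sq_sqrt hd0.le]) hρ.le
  have hm : MeasurableSet {z : EuclideanSpace ℝ (Fin d) |
      inner ℝ u z ≤ Real.sqrt (249 / 10) / Real.sqrt d * ρ} :=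
    measurableSet_le (by fun_prop) measurable_const
  -- The first gap makes the shift strictly longer than the threshold; the gap from 4.999 to 5 later
  -- gives strictness after passing to the infimum over `ρ`.
  have hlt : Real.sqrt (249 / 10) < 4999 / 1000 := by
    rw [Real.sqrt_lt' (by norm_num)]
    norm_num
  refine rsCertifiedRadius_le_of_halfspace hq x c hu (by positivity)
    (s := Real.sqrt (249 / 10) / Real.sqrt d * ρ) (by gcongr) ?_
  have h2 := probReal_compl_eq_one_sub (μ := noise q) hm
  have h3 : {z : EuclideanSpace ℝ (Fin d) |
      inner ℝ u z ≤ Real.sqrt (249 / 10) / Real.sqrt d * ρ}ᶜ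
      = {z | Real.sqrt (249 / 10) / Real.sqrt d * ρ < inner ℝ u z} := by
    ext z
    simp only [Set.mem_compl_iff, Set.mem_ofPred_eq, not_le]
  rw [h3] at h2
  have h4 : ballMass q ρ ≤ 1 := by rw [ballMass_eq hq]; exact measureReal_le_one
  rw [h2] at h
  have h5 : 5 * ((10 : ℝ) ^ 7)⁻¹ = 1 / 2000000 := by norm_num
  rw [h5] at h hp
  linarith

/-- The origin is a null set, so balls shrinking to it lose all their mass. This makes `Ψ⁻¹`
positive, without which the final inequality could not be strict. -/
theorem exists_ballMass_lt (hd : 0 < d) {q : EuclideanSpace ℝ (Fin d) → ℝ}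
    (hq : IsSymmetricDensity q) {s : ℝ} (hs : 0 < s) :
    ∃ r : ℝ≥0, 0 < r ∧ ballMass q r < s := by
  have := hq.isProbabilityMeasure
  have : Nonempty (Fin d) := ⟨⟨0, hd⟩⟩
  have h0 : noise q {0} = 0 := withDensity_absolutelyContinuous _ _ (measure_singleton 0)
  have ht := tendsto_measure_cthickening_of_isClosed (μ := noise q) (s := {0})
    ⟨1, one_pos, measure_ne_top _ _⟩ isClosed_singleton
  rw [h0] at ht
  have h1 := ht.eventually (gt_mem_nhds (ENNReal.ofReal_pos.2 hs))
  have h2 : ∀ᶠ r in nhdsWithin (0 : ℝ) (Set.Ioi 0),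
      noise q (Metric.cthickening r {0}) < ENNReal.ofReal s := h1.filter_mono nhdsWithin_le_nhds
  obtain ⟨r, hr, hr0⟩ := (h2.and self_mem_nhdsWithin).exists
  have hr0' : 0 < r := hr0
  refine ⟨⟨r, hr0'.le⟩, hr0', ?_⟩
  rw [ballMass_eq hq, measureReal_def]
  refine ENNReal.toReal_lt_of_lt_ofReal (lt_of_le_of_lt (measure_mono ?_) hr)
  rw [Metric.cthickening_singleton _ hr0'.le]
  exact Metric.ball_subset_closedBall

theorem ballMassInv_pos (hd : 0 < d) {q : EuclideanSpace ℝ (Fin d) → ℝ}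
    (hq : IsSymmetricDensity q) {s : ℝ} (hs : 0 < s) : 0 < ballMassInv q s := by
  obtain ⟨r, hr0, hr⟩ := exists_ballMass_lt hd hq hs
  refine lt_of_lt_of_le (ENNReal.coe_pos.2 hr0) (le_iInf₂ fun r' hr' => ?_)
  rw [ENNReal.coe_le_coe]
  by_contra hlt
  have := hq.isProbabilityMeasure
  have hle : ballMass q r' ≤ ballMass q r := by
    rw [ballMass_eq hq, ballMass_eq hq]
    exact measureReal_mono (Metric.ball_subset_ball (NNReal.coe_le_coe.2 (not_le.1 hlt).le))
  linarith

theorem rsCertifiedRadius_lt_top [Nontrivial Y] [MeasurableSingletonClass Y] (hd : 0 < d)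
    {q : EuclideanSpace ℝ (Fin d) → ℝ}
    (hq : IsSymmetricDensity q) (x : EuclideanSpace ℝ (Fin d)) (c : Y) {p : ℝ} (hp : p < 1) :
    rsCertifiedRadius q x c p < ⊤ := by
  have := hq.isProbabilityMeasure
  obtain ⟨u, hu⟩ := exists_norm_eq_one hd
  have := Measure.isProbabilityMeasure_map (μ := noise q)
    (f := fun z => inner ℝ u z) (by fun_prop)
  have ht := tendsto_cdf_atTop ((noise q).map (fun z => inner ℝ u z))
  obtain ⟨s, hs, hs0⟩ := ((ht.eventually (lt_mem_nhds hp)).and (Filter.eventually_ge_atTop 0)).exists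
  rw [cdf_eq_real, map_measureReal_apply (by fun_prop) measurableSet_Iic] at hs
  exact (rsCertifiedRadius_le_of_halfspace hq x c hu (r := s + 1) (by linarith) (by linarith)
    hs.le).trans_lt ENNReal.ofReal_lt_top

theorem rsCertifiedRadius_lt [Nontrivial Y] [MeasurableSingletonClass Y] (hd : 0 < d)
    {q : EuclideanSpace ℝ (Fin d) → ℝ}
    (hq : IsSymmetricDensity q) (x : EuclideanSpace ℝ (Fin d)) (c : Y) {p s : ℝ}
    (hp1 : p < 1) (hs : 0 < s) (hp : p ≤ s * (1 - 5 * ((10 : ℝ) ^ 7)⁻¹)) :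
    rsCertifiedRadius q x c p < ENNReal.ofReal (5 / Real.sqrt d) * ballMassInv q s := by
  have hd0 : (0 : ℝ) < d := by exact_mod_cast hd
  have hpos := ballMassInv_pos hd hq hs
  have h5 : 0 < ENNReal.ofReal (5 / Real.sqrt d) := ENNReal.ofReal_pos.2 (by positivity)
  -- When no ball is heavy enough the right side is infinite, and `p < 1` keeps the certified radius
  -- finite.
  by_cases htop : ballMassInv q s = ⊤
  · rw [htop, ENNReal.mul_top h5.ne']
    exact rsCertifiedRadius_lt_top hd hq x c hp1
  have hk : 0 < 4999 / 1000 / Real.sqrt d := by positivity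
  refine lt_of_le_of_lt (b := ENNReal.ofReal (4999 / 1000 / Real.sqrt d) * ballMassInv q s) ?_ ?_
  · rw [ballMassInv, ENNReal.mul_iInf_of_ne (ENNReal.ofReal_pos.2 hk).ne' ENNReal.ofReal_ne_top]
    refine le_iInf fun r => ?_
    rw [ENNReal.mul_iInf_of_ne (ENNReal.ofReal_pos.2 hk).ne' ENNReal.ofReal_ne_top]
    refine le_iInf fun hr => ?_
    have hr0 : 0 < (r : ℝ) := by
      rcases eq_or_ne r 0 with rfl | h
      · simp [ballMass] at hr
        linarith
      · exact NNReal.coe_pos.2 (pos_iff_ne_zero.2 h)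
    refine (rsCertifiedRadius_le_of_ballMass hd hq x c hp hr0 hr).trans (le_of_eq ?_)
    rw [ENNReal.ofReal_mul hk.le, ENNReal.ofReal_coe_nnreal]
  · refine (ENNReal.mul_lt_mul_iff_left hpos.ne' htop).2 ?_
    rw [ENNReal.ofReal_lt_ofReal_iff (by positivity)]
    gcongr
    norm_num

theorem rsCertifiedRadius_lt_psiTerm [Fintype Y] [Nontrivial Y] [MeasurableSingletonClass Y]
    (hd : 0 < d) {q : EuclideanSpace ℝ (Fin d) → ℝ} (hq : IsSymmetricDensity q)
    (f : Kernel (EuclideanSpace ℝ (Fin d)) Y) [IsMarkovKernel f]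
    (x : EuclideanSpace ℝ (Fin d)) (c : Y) {p : ℝ} (hp1 : p < 1) (hp : p ≤ classProb q f x c) :
    ENNReal.ofReal (1 / Real.sqrt 2) * rsCertifiedRadius q x c p
      < ENNReal.ofReal (5 / Real.sqrt (2 * d)) * psiTerm q f x := by
  have hbdd : BddAbove (Set.range fun c => classProb q f x c) := Set.finite_range _ |>.bddAbove
  have hpos : 0 < ⨆ c, classProb q f x c := by
    by_contra hn
    have h1 : ∀ c, classProb q f x c ≤ 0 := fun c => (le_ciSup hbdd c).trans (not_lt.1 hn)
    have h2 := sum_classProb hq f x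
    have h3 : ∑ c, classProb q f x c ≤ 0 := Finset.sum_nonpos fun c _ => h1 c
    linarith
  have hk : (0 : ℝ) < 1 - 5 * ((10 : ℝ) ^ 7)⁻¹ := by norm_num
  have h := rsCertifiedRadius_lt hd hq x c hp1 (div_pos hpos hk) (by
    rw [div_mul_cancel₀ _ hk.ne']
    exact hp.trans (le_ciSup hbdd c))
  have h2 : 5 / Real.sqrt (2 * d) = 1 / Real.sqrt 2 * (5 / Real.sqrt d) := by
    rw [Real.sqrt_mul two_pos.le]
    ring
  rw [h2, ENNReal.ofReal_mul (by positivity), mul_assoc]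
  exact (ENNReal.mul_lt_mul_iff_right (ENNReal.ofReal_pos.2 (by positivity)).ne'
    ENNReal.ofReal_ne_top).2 h

end Radius

/-! ### Comparison of constants and assembly. -/

/-- Twice the smaller dimension is at most `m + n`, so one summand alone reaches the left side and
the other is positive. -/
theorem five_div_sqrt_add_lt {m n : ℕ} (hm : 0 < m) (hn : 0 < n) :
    5 / Real.sqrt ((m + n : ℕ) : ℝ) < 5 / Real.sqrt (2 * m) + 5 / Real.sqrt (2 * n) := by
  have hm' : (0 : ℝ) < m := by exact_mod_cast hm
  have hn' : (0 : ℝ) < n := by exact_mod_cast hn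
  have h1 : 0 < 5 / Real.sqrt (2 * m) := by positivity
  have h2 : 0 < 5 / Real.sqrt (2 * n) := by positivity
  push_cast
  rcases le_total (m : ℝ) n with h | h
  · have : 5 / Real.sqrt (m + n) ≤ 5 / Real.sqrt (2 * m) := by
      gcongr
      linarith
    linarith
  · have : 5 / Real.sqrt (m + n) ≤ 5 / Real.sqrt (2 * n) := by
      gcongr
      linarith
    linarith

theorem mainTheorem2 {Y : Type*} [Fintype Y] [Nontrivial Y] [MeasurableSpace Y]
    [MeasurableSingletonClass Y] {m n d : ℕ} (hm : 0 < m) (hn : 0 < n)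
    (e : Fin m ⊕ Fin n ≃ Fin d) (x : EuclideanSpace ℝ (Fin d))
    (fl : Kernel (EuclideanSpace ℝ (Fin m)) Y) [IsMarkovKernel fl]
    (fr : Kernel (EuclideanSpace ℝ (Fin n)) Y) [IsMarkovKernel fr] (cA : Y) :
    -- Gaussian noise: relation between the DRS radius and the RS radii of the sub-inputs
    (∀ σ pl pr : ℝ, 0 < σ → 0 < pl → pl < 1 → 0 < pr → pr < 1 →
      drsRadius σ pl pr (1 - pl) (1 - pr)
          = 1 / Real.sqrt 2 * (rsRadius σ pl (1 - pl) + rsRadius σ pr (1 - pr)) ∧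
      rsCertifiedRadius (gaussianDensity σ m) (subL e x) cA pl
          = ENNReal.ofReal (rsRadius σ pl (1 - pl)) ∧
      rsCertifiedRadius (gaussianDensity σ n) (subR e x) cA pr
          = ENNReal.ofReal (rsRadius σ pr (1 - pr))) ∧
    -- Gaussian noise: upper bound on the DRS radius
    (∀ σ pl pr : ℝ, 0 < σ → 0 < pl → pl < 1 → 0 < pr → pr < 1 →
      pl ≤ classProb (gaussianDensity σ m) fl (subL e x) cA →
      pr ≤ classProb (gaussianDensity σ n) fr (subR e x) cA →
      ENNReal.ofReal (drsRadius σ pl pr (1 - pl) (1 - pr))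
        < ENNReal.ofReal (5 / Real.sqrt (2 * m)) * psiTerm (gaussianDensity σ m) fl (subL e x)
          + ENNReal.ofReal (5 / Real.sqrt (2 * n))
            * psiTerm (gaussianDensity σ n) fr (subR e x)) ∧
    -- arbitrary continuous origin-symmetric noise: upper bound
    (∀ (ql : EuclideanSpace ℝ (Fin m) → ℝ) (qr : EuclideanSpace ℝ (Fin n) → ℝ),
      IsSymmetricDensity ql → IsSymmetricDensity qr →
      ∀ pl pr : ℝ, pl < 1 → pr < 1 →
      pl ≤ classProb ql fl (subL e x) cA → pr ≤ classProb qr fr (subR e x) cA →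
      ENNReal.ofReal (1 / Real.sqrt 2)
          * (rsCertifiedRadius ql (subL e x) cA pl + rsCertifiedRadius qr (subR e x) cA pr)
        < ENNReal.ofReal (5 / Real.sqrt (2 * m)) * psiTerm ql fl (subL e x)
          + ENNReal.ofReal (5 / Real.sqrt (2 * n)) * psiTerm qr fr (subR e x)) ∧
    -- the rate of the bound, and its constant compared with that of RS in dimension `d`
    (∀ (ql : EuclideanSpace ℝ (Fin m) → ℝ) (qr : EuclideanSpace ℝ (Fin n) → ℝ) (C : ℝ≥0∞),
      psiTerm ql fl (subL e x) ≤ C → psiTerm qr fr (subR e x) ≤ C →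
      ENNReal.ofReal (5 / Real.sqrt (2 * m)) * psiTerm ql fl (subL e x)
          + ENNReal.ofReal (5 / Real.sqrt (2 * n)) * psiTerm qr fr (subR e x)
        ≤ ENNReal.ofReal (5 / Real.sqrt 2 * (1 / Real.sqrt m + 1 / Real.sqrt n)) * C) ∧
    m + n = d ∧ 5 / Real.sqrt d < 5 / Real.sqrt (2 * m) + 5 / Real.sqrt (2 * n) := by
  have hd : m + n = d := by
    have := Fintype.card_congr e
    simpa using this
  have h3 : ∀ (ql : EuclideanSpace ℝ (Fin m) → ℝ) (qr : EuclideanSpace ℝ (Fin n) → ℝ),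
      IsSymmetricDensity ql → IsSymmetricDensity qr →
      ∀ pl pr : ℝ, pl < 1 → pr < 1 →
      pl ≤ classProb ql fl (subL e x) cA → pr ≤ classProb qr fr (subR e x) cA →
      ENNReal.ofReal (1 / Real.sqrt 2)
          * (rsCertifiedRadius ql (subL e x) cA pl + rsCertifiedRadius qr (subR e x) cA pr)
        < ENNReal.ofReal (5 / Real.sqrt (2 * m)) * psiTerm ql fl (subL e x)
          + ENNReal.ofReal (5 / Real.sqrt (2 * n)) * psiTerm qr fr (subR e x) := by
    intro ql qr hql hqr pl pr hl hr hpl hpr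
    rw [mul_add]
    exact ENNReal.add_lt_add (rsCertifiedRadius_lt_psiTerm hm hql fl (subL e x) cA hl hpl)
      (rsCertifiedRadius_lt_psiTerm hn hqr fr (subR e x) cA hr hpr)
  refine ⟨fun σ pl pr hσ hl0 hl1 hr0 hr1 => ⟨drsRadius_one_sub σ hl0 hl1 hr0 hr1,
    rsCertifiedRadius_gaussianDensity hσ hm _ cA hl0 hl1,
    rsCertifiedRadius_gaussianDensity hσ hn _ cA hr0 hr1⟩, ?_, h3, ?_, hd, ?_⟩
  · intro σ pl pr hσ hl0 hl1 hr0 hr1 hpl hpr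
    refine lt_of_le_of_lt ?_ (h3 _ _ (isSymmetricDensity_gaussianDensity hσ m)
      (isSymmetricDensity_gaussianDensity hσ n) pl pr hl1 hr1 hpl hpr)
    rw [drsRadius_one_sub σ hl0 hl1 hr0 hr1, rsCertifiedRadius_gaussianDensity hσ hm _ cA hl0 hl1,
      rsCertifiedRadius_gaussianDensity hσ hn _ cA hr0 hr1, ENNReal.ofReal_mul (by positivity)]
    gcongr
    -- Truncation at zero is subadditive, which covers negative Gaussian radii.
    exact ENNReal.ofReal_add_le
  · intro ql qr C hl hr
    have h : 5 / Real.sqrt 2 * (1 / Real.sqrt m + 1 / Real.sqrt n)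
        = 5 / Real.sqrt (2 * m) + 5 / Real.sqrt (2 * n) := by
      rw [Real.sqrt_mul two_pos.le, Real.sqrt_mul two_pos.le]
      ring
    rw [h, ENNReal.ofReal_add (by positivity) (by positivity), add_mul]
    gcongr
  · rw [← hd]
    exact five_div_sqrt_add_lt hm hn
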